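/- Let $H\in\mathbb C^{n\times n}$ be Hermitian, $V\in\mathbb C^{n\times b}$ and $k\ge 1$, and assume that the block Krylov space spanned by the columns of $V,HV,\dots,H^kV$ has dimension $(k+1)b$. Let $Q_1,\dots,Q_{k+1}\in\mathbb C^{n\times b}$ and $A_1,\dots,A_k,B_0,\dots,B_k\in\mathbb C^{b\times b}$ be produced in exact arithmetic by $k$ steps of the block-Lanczos algorithm: $V=Q_1B_0$ is a thin QR factorization (the columns of $Q_1$ are orthonormal, $B_0$ is upper triangular) and, for $j=1,\dots,k$ (with $Q_0=0$), $$A_j=Q_j^*\bigl(HQ_j-Q_{j-1}B_{j-1}^*\bigr),\qquad HQ_j-Q_{j-1}B_{j-1}^*-Q_jA_j=Q_{j+1}B_j \ \text{ is a thin QR factorization.}$$ Let $Q=[Q_1\ \cdots\ Q_k]$, let $T$ be the $kb\times kb$ block tridiagonal matrix with diagonal blocks $A_1,\dots,A_k$, subdiagonal blocks $B_1,\dots,B_{k-1}$ and superdiagonal blocks $B_1^*,\dots,B_{k-1}^*$, and let $E_i$ be the $kb\times b$ matrix whose $i$-th $b\times b$ block is the identity and whose other blocks are zero. Put $$\mathsf{lan}_k(f)=Qf(T)E_1B_0,\qquad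 \mathsf{err}_k(z)=(H-zI)^{-1}V-Q(T-zI)^{-1}E_1B_0,\qquad C(u)=-E_k^*(T-uI)^{-1}E_1B_0 .$$ Let $\Lambda(\cdot)$ denote the spectrum, let $S\subseteq\mathbb R$ be any set with $\Lambda(H)\subseteq S$, and let $Q_S(w,z)=\sup_{x\in S}|x-w|/|x-z|\in[0,\infty]$. Let $w\in\mathbb C\setminus(\Lambda(H)\cup\Lambda(T))$ be such that $C(w)$ is invertible. Let $\Gamma$ be a finite union of positively oriented rectifiable simple closed curves such that each point of $\Lambda(H)\cup\Lambda(T)$ lies on none of the curves and inside exactly one of them, and let $f:\mathbb C\to\mathbb C$ be analytic in the interior of each curve and continuous on each closed region consisting of a curve and its interior. Then $$\|f(H)V-\mathsf{lan}_k(f)\|\le\left(\frac1{2\pi}\oint_\Gamma|f(z)|\,Q_S(w,z)\,\|C(w)^{-1}C(z)\|_2\,|dz|\right)\|\mathsf{err}_k(w)\|$$ for every norm $\|X\|=\|h(H)^{1/2}X\|_{\mathsf F}$ with $h:\mathbb R\to\mathbb R$ such that $h(H)$ is positive definite, and also for the operator norm $\|\cdot\|=\|\cdot\|_2$. (The inequality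 is between elements of $[0,\infty]$, with $0\cdot\infty=0$; the integral over $\Gamma$ is the sum of the integrals over its curves.) -/

import Mathlib

open Matrix
open scoped Matrix.Norms.L2Operator ComplexOrder ENNReal

noncomputable section

namespace BlockLanczos

variable {n b : ℕ}

/-- The block Krylov space spanned by the columns of `V, H V, …, H ^ (j - 1) V`. -/
def krylov (H : Matrix (Fin n) (Fin n) ℂ) (V : Matrix (Fin n) (Fin b) ℂ) (j : ℕ) :
    Submodule ℂ (Fin n → ℂ) :=
  Submodule.span ℂ {v | ∃ i < j, ∃ q : Fin b, v = fun r => (H ^ i * V) r q}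

/-- `Z = Q R` is a thin QR factorization: `Q` has orthonormal columns, `R` is upper triangular. -/
structure IsThinQR (Z Q : Matrix (Fin n) (Fin b) ℂ) (R : Matrix (Fin b) (Fin b) ℂ) : Prop where
  eq_mul : Z = Q * R
  orthonormal : Qᴴ * Q = 1
  upper : ∀ p q : Fin b, q < p → R p q = 0

/-- `Q₁, …, Q_{k+1}`, `A₁, …, A_k`, `B₀, …, B_k` are produced by `k` steps of the block-Lanczos
algorithm (in exact arithmetic) applied to `H` and `V`; the factors of each QR factorization may
be chosen in any way. The convention `Q₀ = 0` makes the first step `Z = H Q₁`. -/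
structure IsOutput (H : Matrix (Fin n) (Fin n) ℂ) (V : Matrix (Fin n) (Fin b) ℂ) (k : ℕ)
    (Q : ℕ → Matrix (Fin n) (Fin b) ℂ) (A B : ℕ → Matrix (Fin b) (Fin b) ℂ) : Prop where
  zero : Q 0 = 0
  init : IsThinQR V (Q 1) (B 0)
  diag : ∀ j, 1 ≤ j → j ≤ k → A j = (Q j)ᴴ * (H * Q j - Q (j - 1) * (B (j - 1))ᴴ)
  step : ∀ j, 1 ≤ j → j ≤ k →
    IsThinQR (H * Q j - Q (j - 1) * (B (j - 1))ᴴ - Q j * A j) (Q (j + 1)) (B j)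

/-- The block vector `E_i` (with `i` counted from `1`): its `i`-th block is the identity and its
other blocks vanish. -/
def blockE (k b : ℕ) (i : ℕ) : Matrix (Fin k × Fin b) (Fin b) ℂ :=
  Matrix.of fun x q => if (x.1 : ℕ) + 1 = i ∧ x.2 = q then 1 else 0

/-- The matrix `[Q₁ ⋯ Q_k]`. -/
def basis (k : ℕ) (Q : ℕ → Matrix (Fin n) (Fin b) ℂ) : Matrix (Fin n) (Fin k × Fin b) ℂ :=
  Matrix.of fun r x => Q (x.1 + 1) r x.2

/-- The block tridiagonal matrix with diagonal blocks `A₁, …, A_k`, subdiagonal blocks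
`B₁, …, B_{k-1}` and superdiagonal blocks `B₁ᴴ, …, B_{k-1}ᴴ`. -/
def tridiag (k : ℕ) (A B : ℕ → Matrix (Fin b) (Fin b) ℂ) :
    Matrix (Fin k × Fin b) (Fin k × Fin b) ℂ :=
  Matrix.of fun x y =>
    if (x.1 : ℕ) = y.1 then A (x.1 + 1) x.2 y.2
    else if (x.1 : ℕ) = y.1 + 1 then B x.1 x.2 y.2
    else if (y.1 : ℕ) = x.1 + 1 then (B y.1)ᴴ x.2 y.2
    else 0

/-- The block-Lanczos approximation `Q f(T) E₁ B₀` to `f(H) V`. -/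
def lan (k : ℕ) (Q : ℕ → Matrix (Fin n) (Fin b) ℂ) (A B : ℕ → Matrix (Fin b) (Fin b) ℂ)
    (f : ℂ → ℂ) : Matrix (Fin n) (Fin b) ℂ :=
  basis k Q * cfc f (tridiag k A B) * blockE k b 1 * B 0

/-- The error `(H - z)⁻¹ V - Q (T - z)⁻¹ E₁ B₀` of the approximation to `(H - z)⁻¹ V`. -/
def err (H : Matrix (Fin n) (Fin n) ℂ) (V : Matrix (Fin n) (Fin b) ℂ) (k : ℕ)
    (Q : ℕ → Matrix (Fin n) (Fin b) ℂ) (A B : ℕ → Matrix (Fin b) (Fin b) ℂ) (z : ℂ) :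
    Matrix (Fin n) (Fin b) ℂ :=
  (H - z • 1)⁻¹ * V - basis k Q * (tridiag k A B - z • 1)⁻¹ * blockE k b 1 * B 0

/-- `C(u) = -E_kᴴ (T - u)⁻¹ E₁ B₀`. -/
def blockC (k : ℕ) (A B : ℕ → Matrix (Fin b) (Fin b) ℂ) (u : ℂ) : Matrix (Fin b) (Fin b) ℂ :=
  -((blockE k b k)ᴴ * (tridiag k A B - u • 1)⁻¹ * blockE k b 1 * B 0)

/-- `Q_S(w, z)`, the supremum of `|x - w| / |x - z|` over `x ∈ S`, as an element of `[0, ∞]`. -/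
def ratioSup (S : Set ℝ) (w z : ℂ) : ℝ≥0∞ :=
  ⨆ x ∈ S, ‖(x : ℂ) - w‖ₑ / ‖(x : ℂ) - z‖ₑ

def frobeniusNorm (X : Matrix (Fin n) (Fin b) ℂ) : ℝ :=
  √(∑ i, ∑ j, ‖X i j‖ ^ 2)

/-- The norm `X ↦ ‖M ^ (1/2) X‖_F` induced by a positive definite matrix `M`. -/
def inducedNorm (M : Matrix (Fin n) (Fin n) ℂ) (X : Matrix (Fin n) (Fin b) ℂ) : ℝ :=
  frobeniusNorm (cfc Real.sqrt M * X)

/-- A rectifiable, positively oriented simple closed curve in `ℂ`, given by a Lipschitz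
parametrization on `[0, 1]` (the arc length parametrization of a rectifiable curve, rescaled,
is one). Its inside consists of the bounded components of the complement, and it is positively
oriented when its winding number around the points inside is `1`. -/
structure Curve where
  toFun : ℝ → ℂ
  lipschitz : ∃ K, LipschitzOnWith K toFun (Set.Icc 0 1)
  closed : toFun 0 = toFun 1
  simple : Set.InjOn toFun (Set.Ico 0 1)
  positive : ∀ z ∉ toFun '' Set.Icc 0 1,
    Bornology.IsBounded (connectedComponentIn (toFun '' Set.Icc 0 1)ᶜ z) →
      (2 * Real.pi * Complex.I)⁻¹ * ∫ t in (0 : ℝ)..1, deriv toFun t / (toFun t - z) = 1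

namespace Curve

/-- The set of points on the curve. -/
def trace (γ : Curve) : Set ℂ := γ.toFun '' Set.Icc 0 1

/-- The open region bounded by the curve. -/
def inside (γ : Curve) : Set ℂ :=
  {z | z ∉ γ.trace ∧ Bornology.IsBounded (connectedComponentIn γ.traceᶜ z)}

/-- The integral of `g` over the curve with respect to arc length `|dz|`. -/
def arcIntegral (γ : Curve) (g : ℂ → ℝ≥0∞) : ℝ≥0∞ :=
  ∫⁻ t in Set.Icc (0 : ℝ) 1, g (γ.toFun t) * ‖deriv γ.toFun t‖ₑ

end Curve

/-- The point `z` lies on none of the curves and inside exactly one of them. -/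
def Encloses {m : ℕ} (Γ : Fin m → Curve) (z : ℂ) : Prop :=
  (∀ i, z ∉ (Γ i).trace) ∧ ∃! i, z ∈ (Γ i).inside

/-- `(2π)⁻¹ ∮_Γ |f(z)| Q_S(w, z) ‖C(w)⁻¹ C(z)‖₂ |dz|`, as an element of `[0, ∞]`. -/
def integralTerm {m : ℕ} (Γ : Fin m → Curve) (f : ℂ → ℂ) (S : Set ℝ) (k : ℕ)
    (A B : ℕ → Matrix (Fin b) (Fin b) ℂ) (w : ℂ) : ℝ≥0∞ :=
  (ENNReal.ofReal (2 * Real.pi))⁻¹ *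
    ∑ i, (Γ i).arcIntegral fun z =>
      ‖f z‖ₑ * ratioSup S w z * ENNReal.ofReal ‖(blockC k A B w)⁻¹ * blockC k A B z‖

end BlockLanczos

end

/-! The bound rests on an exact formula for the resolvent errors. The three-term recurrence says `H
Q = Q T + Q_{k+1} B_k E_kᴴ`, and `V = Q E₁ B₀`. Hence `(H - z) err(z) = Q_{k+1} B_k C(z)`: only the
factor `C(z)` of the residual depends on `z`. Comparing `z` with `w` gives `err(z) = (H - z)⁻¹ (H -
w) err(w) C(w)⁻¹ C(z)`. On the other hand `f(H) V - lan_k(f) = -(2πi)⁻¹ ∮ f(z) err(z) dz`, by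
Cauchy's formula at each point of the two finite spectra. Taking norms under the integral, `‖(H -
z)⁻¹ (H - w)‖₂ ≤ Q_S(w, z)` by the spectral theorem. The norms considered tolerate left factors that
are functions of `H` and arbitrary right factors.

The spectral calculus for `T` needs `T` Hermitian. This is where the dimension hypothesis enters: it
makes `B_0, …, B_{k-1}` invertible, so consecutive blocks `Q_j`, `Q_{j+1}` with `j < k` are
orthogonal and each `A_j` equals `Q_jᴴ H Q_j`. A rank-deficient QR factorization could destroy this
orthogonality.

The analytic core is Cauchy's theorem on a rectifiable Jordan curve for `F` holomorphic inside and
only continuous up to the curve. Extend `F` to the plane with compact support and replace `π δ²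
F(ζ)` by the integral of `F` over the disc of radius `δ` about `ζ`. That integral is a Cauchy
transform of the circle moments of `F`, a discrete form of `∂F/∂z̄`. By Fubini, its integral along
the curve becomes an area integral of circle moment times winding number. The product vanishes
outside the `δ`-neighbourhood of the curve, which has area `O(δ)`, and the moment is `O(δ ε)` with
`ε` the oscillation of `F` at scale `δ`. So the total is `O(δ² ε)`, and division by `π δ²` leaves
`O(ε)`. -/

namespace BlockLanczos

/-! ### Cauchy kernels in the plane and circle moments. -/

section CircleMoments

open MeasureTheory Metric Complex

theorem integrableOn_inv_norm_ball :
    IntegrableOn (fun z : ℂ => ‖z‖⁻¹) (ball 0 1) := by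
  refine integrableOn_ball_of_norm_le_rpow (μ := volume) (C := 1) (α := 1) (by simp) (by simp)
    ?_ ?_
  · refine Filter.Eventually.of_forall fun z => ?_
    simp [Real.rpow_neg_one]
  · exact (measurable_norm.inv).aestronglyMeasurable

/-- The kernel is at most `1` outside the unit disc about `ζ`, and inside it is a translate of the
locally integrable `1/|z|`. The uniformity in `ζ` is what permits Fubini along a path. -/
theorem exists_lintegral_cauchyKernel_le (R : ℝ) :
    ∃ C : ℝ≥0∞, C ≠ ⊤ ∧ ∀ ζ : ℂ, ∫⁻ z in closedBall (0 : ℂ) R, ‖(z - ζ)⁻¹‖ₑ ≤ C := by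
  refine ⟨(∫⁻ z in ball (0 : ℂ) 1, ‖‖z‖⁻¹‖ₑ) + volume (closedBall (0 : ℂ) R), ?_, fun ζ => ?_⟩
  · exact ENNReal.add_ne_top.2 ⟨integrableOn_inv_norm_ball.2.ne, measure_closedBall_lt_top.ne⟩
  · have hpt : ∀ z : ℂ, ‖(z - ζ)⁻¹‖ₑ ≤
        (ball (0 : ℂ) 1).indicator (fun z => ‖‖z‖⁻¹‖ₑ) (z - ζ) + 1 := by
      intro z
      by_cases hz : z - ζ ∈ ball (0 : ℂ) 1
      · rw [Set.indicator_of_mem hz]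
        refine le_add_right (le_of_eq ?_)
        rw [← norm_inv, enorm_norm]
      · refine le_add_left ?_
        rw [mem_ball_zero_iff, not_lt] at hz
        rw [← ofReal_norm, norm_inv]
        exact ENNReal.ofReal_le_one.2 (inv_le_one_of_one_le₀ hz)
    calc ∫⁻ z in closedBall (0 : ℂ) R, ‖(z - ζ)⁻¹‖ₑ
        ≤ ∫⁻ z in closedBall (0 : ℂ) R,
            ((ball (0 : ℂ) 1).indicator (fun z => ‖‖z‖⁻¹‖ₑ) (z - ζ) + 1) :=
          lintegral_mono hpt
      _ = (∫⁻ z in closedBall (0 : ℂ) R,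
            (ball (0 : ℂ) 1).indicator (fun z => ‖‖z‖⁻¹‖ₑ) (z - ζ)) +
            volume (closedBall (0 : ℂ) R) := by
          rw [lintegral_add_right _ measurable_const]; simp
      _ ≤ (∫⁻ z, (ball (0 : ℂ) 1).indicator (fun z => ‖‖z‖⁻¹‖ₑ) (z - ζ)) +
            volume (closedBall (0 : ℂ) R) := by
          gcongr; exact Measure.restrict_le_self
      _ = _ := by
          rw [lintegral_sub_right_eq_self, lintegral_indicator measurableSet_ball]

/-- The Cauchy kernel along a path, weighted by a bounded function supported over a bounded set,
is integrable on the product of the plane and the parameter space. -/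
theorem integrable_mul_cauchyKernel {ν : Measure ℝ} [IsFiniteMeasure ν] {c : ℝ → ℂ}
    (hc : Measurable c) {G : ℂ × ℝ → ℂ} (hG : Measurable G) {M R : ℝ} (hM : ∀ p, ‖G p‖ ≤ M)
    (hR : ∀ p, R < ‖p.1‖ → G p = 0) :
    Integrable (fun p : ℂ × ℝ => G p * (p.1 - c p.2)⁻¹) (volume.prod ν) := by
  have hmeas : Measurable (fun p : ℂ × ℝ => G p * (p.1 - c p.2)⁻¹) :=
    hG.mul ((measurable_fst.sub (hc.comp measurable_snd)).inv)
  refine ⟨hmeas.aestronglyMeasurable, ?_⟩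
  obtain ⟨C, hC, hCle⟩ := exists_lintegral_cauchyKernel_le R
  rw [HasFiniteIntegral, lintegral_prod_symm' _ hmeas.enorm]
  have hin : ∀ t : ℝ, ∫⁻ z : ℂ, ‖G (z, t) * (z - c t)⁻¹‖ₑ ≤ ENNReal.ofReal M * C := by
    intro t
    calc ∫⁻ z : ℂ, ‖G (z, t) * (z - c t)⁻¹‖ₑ
        ≤ ∫⁻ z : ℂ, (closedBall (0 : ℂ) R).indicator
            (fun z => ENNReal.ofReal M * ‖(z - c t)⁻¹‖ₑ) z := by
          refine lintegral_mono fun z => ?_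
          by_cases hz : z ∈ closedBall (0 : ℂ) R
          · rw [Set.indicator_of_mem hz, enorm_mul]
            gcongr
            rw [← ofReal_norm]
            exact ENNReal.ofReal_le_ofReal (hM _)
          · rw [mem_closedBall_zero_iff, not_le] at hz
            simp [hR (z, t) hz]
      _ = ENNReal.ofReal M * ∫⁻ z in closedBall (0 : ℂ) R, ‖(z - c t)⁻¹‖ₑ := by
          rw [lintegral_indicator measurableSet_closedBall,
            lintegral_const_mul' _ _ ENNReal.ofReal_ne_top]
      _ ≤ _ := by gcongr; exact hCle _
  calc ∫⁻ t, ∫⁻ z : ℂ, ‖G (z, t) * (z - c t)⁻¹‖ₑ ∂volume ∂ν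
      ≤ ∫⁻ _, ENNReal.ofReal M * C ∂ν := lintegral_mono hin
    _ < ⊤ := by
      rw [lintegral_const]
      exact ENNReal.mul_lt_top (ENNReal.mul_lt_top ENNReal.ofReal_lt_top hC.lt_top)
        (measure_lt_top _ _)

theorem integral_circleMap_mul_inv_sub {δ : ℝ} (hδ : 0 < δ) {u : ℂ} (hu : ‖u‖ ≠ δ) :
    ∫ θ in (0 : ℝ)..2 * Real.pi, circleMap 0 δ θ * (circleMap 0 δ θ - u)⁻¹ =
      if ‖u‖ < δ then 2 * (Real.pi : ℂ) else 0 := by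
  have h : (∮ z in C(0, δ), (z - u)⁻¹) =
      I * ∫ θ in (0 : ℝ)..2 * Real.pi, circleMap 0 δ θ * (circleMap 0 δ θ - u)⁻¹ := by
    rw [circleIntegral, ← intervalIntegral.integral_const_mul]
    refine intervalIntegral.integral_congr fun θ _ => ?_
    simp only [deriv_circleMap, smul_eq_mul]
    ring
  split_ifs with hlt
  · rw [circleIntegral.integral_sub_inv_of_mem_ball (by simpa using hlt)] at h
    have : I * ((∫ θ in (0 : ℝ)..2 * Real.pi, circleMap 0 δ θ * (circleMap 0 δ θ - u)⁻¹) -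
      2 * Real.pi) = 0 := by rw [mul_sub, ← h]; ring
    simpa [sub_eq_zero] using this
  · have hne : ∀ z ∈ closedBall (0 : ℂ) δ, z - u ≠ 0 := by
      intro z hz h0
      rw [sub_eq_zero] at h0
      subst h0
      exact hlt (lt_of_le_of_ne (by simpa using hz) hu)
    have h0 : (∮ z in C(0, δ), (z - u)⁻¹) = 0 :=
      circleIntegral_eq_zero_of_differentiable_on_off_countable hδ.le Set.countable_empty
        (ContinuousOn.inv₀ (by fun_prop) hne)
        (fun z hz => ((differentiableAt_id.sub_const u).inv (hne z (ball_subset_closedBall hz.1))))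
    rw [h0] at h
    simpa using h.symm

theorem integral_circleMap_eq_zero (δ : ℝ) :
    ∫ θ in (0 : ℝ)..2 * Real.pi, circleMap 0 δ θ = 0 := by
  have h : (∮ z in C(0, |δ|), (1 : ℂ)) = 0 :=
    circleIntegral_eq_zero_of_differentiable_on_off_countable (abs_nonneg _) Set.countable_empty
      (by fun_prop) (fun z _ => by fun_prop)
  rw [circleIntegral] at h
  rcases abs_choice δ with h' | h'
  · rw [h'] at h
    simpa [deriv_circleMap] using h
  · rw [h'] at h
    have : ∀ θ, circleMap 0 (-δ) θ = - circleMap 0 δ θ := by intro θ; simp [circleMap]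
    simpa [deriv_circleMap, this] using h

/-- The first moment of `F` on the circle of radius `δ` about `z`. For smooth `F` it is, up to a
constant factor, the integral of `∂F/∂z̄` over the disc. -/
noncomputable def circleMoment (F : ℂ → ℂ) (δ : ℝ) (z : ℂ) : ℂ :=
  ∫ θ in (0 : ℝ)..2 * Real.pi, F (z - circleMap 0 δ θ) * circleMap 0 δ θ

theorem continuous_circleMoment {F : ℂ → ℂ} (hF : Continuous F) (δ : ℝ) :
    Continuous (circleMoment F δ) := by
  unfold circleMoment
  apply intervalIntegral.continuous_parametric_intervalIntegral_of_continuous'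
  fun_prop

/-- The circle has mean zero, so `F z` can be subtracted from the integrand. Only the oscillation of
`F` then counts. -/
theorem norm_circleMoment_le {F : ℂ → ℂ} (hF : Continuous F) {δ ε : ℝ} (hδ : 0 ≤ δ)
    (h : ∀ x y : ℂ, ‖x - y‖ ≤ δ → ‖F x - F y‖ ≤ ε) (z : ℂ) :
    ‖circleMoment F δ z‖ ≤ 2 * Real.pi * δ * ε := by
  have heq : circleMoment F δ z =
      ∫ θ in (0 : ℝ)..2 * Real.pi, (F (z - circleMap 0 δ θ) - F z) * circleMap 0 δ θ := by
    simp_rw [sub_mul]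
    rw [intervalIntegral.integral_sub, intervalIntegral.integral_const_mul,
      integral_circleMap_eq_zero, mul_zero, sub_zero, circleMoment]
    · exact (by fun_prop : Continuous _).intervalIntegrable _ _
    · exact (by fun_prop : Continuous _).intervalIntegrable _ _
  rw [heq]
  refine (intervalIntegral.norm_integral_le_of_norm_le_const (C := ε * δ) ?_).trans ?_
  · intro θ _
    rw [norm_mul, norm_circleMap_zero, abs_of_nonneg hδ]
    gcongr
    apply h
    rw [sub_sub_cancel_left, norm_neg, norm_circleMap_zero, abs_of_nonneg hδ]
  · rw [sub_zero, abs_of_pos Real.two_pi_pos]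
    exact le_of_eq (by ring)

theorem circleMoment_eq_zero_of_differentiableOn {F : ℂ → ℂ} {U : Set ℂ} (hU : IsOpen U)
    (hF : DifferentiableOn ℂ F U) {δ : ℝ} (hδ : 0 ≤ δ) {z : ℂ} (hz : closedBall z δ ⊆ U) :
    circleMoment F δ z = 0 := by
  have hd : ∀ u ∈ closedBall (0 : ℂ) δ, DifferentiableAt ℂ (fun u => F (z - u)) u := by
    intro u hu
    have : z - u ∈ U := hz (by simpa [dist_eq_norm] using hu)
    exact DifferentiableAt.comp u ((hF _ this).differentiableAt (hU.mem_nhds this)) (by fun_prop)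
  have h := circleIntegral_eq_zero_of_differentiable_on_off_countable hδ Set.countable_empty
    (fun u hu => (hd u hu).continuousAt.continuousWithinAt)
    (fun u hu => hd u (ball_subset_closedBall hu.1))
  have heq : (∮ u in C(0, δ), F (z - u)) = I * circleMoment F δ z := by
    rw [circleIntegral, circleMoment, ← intervalIntegral.integral_const_mul]
    refine intervalIntegral.integral_congr fun θ _ => ?_
    simp only [deriv_circleMap, smul_eq_mul]
    ring
  rw [heq] at h
  simpa using h

theorem circleMoment_eq_zero_of_lt_norm {F : ℂ → ℂ} {R δ : ℝ} (hδ : 0 ≤ δ)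
    (hF : ∀ z, R < ‖z‖ → F z = 0) {z : ℂ} (hz : R + δ < ‖z‖) : circleMoment F δ z = 0 := by
  have : ∀ θ, F (z - circleMap 0 δ θ) = 0 := by
    intro θ
    apply hF
    have := norm_sub_norm_le z (circleMap 0 δ θ)
    rw [norm_circleMap_zero, abs_of_nonneg hδ] at this
    linarith
  simp [circleMoment, this]

/-- The integral of `F` over a disc is a Cauchy transform of the circle moments of `F`. -/
theorem integral_circleMoment_mul_cauchyKernel {F : ℂ → ℂ} (hF : Continuous F) {M R δ : ℝ}
    (hδ : 0 < δ) (hM : ∀ z, ‖F z‖ ≤ M) (hR : ∀ z, R < ‖z‖ → F z = 0) (ζ : ℂ) :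
    ∫ z, circleMoment F δ z * (z - ζ)⁻¹ = 2 * Real.pi * ∫ a in ball ζ δ, F a := by
  set ν : Measure ℝ := volume.restrict (Set.Ioc 0 (2 * Real.pi)) with hν
  have hfin : IsFiniteMeasure ν := by rw [hν]; infer_instance
  have hM0 : 0 ≤ M := (norm_nonneg _).trans (hM 0)
  have h1 : Integrable (fun p : ℂ × ℝ =>
      (F (p.1 - circleMap 0 δ p.2) * circleMap 0 δ p.2) * (p.1 - ζ)⁻¹) (volume.prod ν) := by
    refine integrable_mul_cauchyKernel (c := fun _ => ζ) measurable_const (M := M * δ)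
      (R := R + δ) (Continuous.measurable (by fun_prop)) ?_ ?_
    · intro p
      rw [norm_mul, norm_circleMap_zero, abs_of_pos hδ]
      gcongr
      exact hM _
    · intro p hp
      rw [hR, zero_mul]
      have := norm_sub_norm_le p.1 (circleMap 0 δ p.2)
      rw [norm_circleMap_zero, abs_of_pos hδ] at this
      linarith
  have h2 : Integrable (fun p : ℂ × ℝ =>
      (F p.1 * circleMap 0 δ p.2) * (p.1 - (ζ - circleMap 0 δ p.2))⁻¹) (volume.prod ν) := by
    refine integrable_mul_cauchyKernel (c := fun θ => ζ - circleMap 0 δ θ)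
      (Continuous.measurable (by fun_prop)) (M := M * δ)
      (R := R) (Continuous.measurable (by fun_prop)) ?_ ?_
    · intro p
      rw [norm_mul, norm_circleMap_zero, abs_of_pos hδ]
      gcongr
      exact hM _
    · intro p hp
      rw [hR _ hp, zero_mul]
  -- The `θ`-integral is a winding number of the circle, so it produces the indicator of the disc.
  -- The exceptional circle has measure zero.
  have hinner : ∀ a : ℂ, a ∉ sphere ζ δ →
      ∫ θ, (F a * circleMap 0 δ θ) * (a - (ζ - circleMap 0 δ θ))⁻¹ ∂ν =
        (ball ζ δ).indicator (fun a => 2 * Real.pi * F a) a := by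
    intro a ha
    have hne : ‖ζ - a‖ ≠ δ := by
      rwa [mem_sphere, dist_comm, dist_eq_norm] at ha
    rw [hν, ← intervalIntegral.integral_of_le Real.two_pi_pos.le]
    have : ∀ θ, (F a * circleMap 0 δ θ) * (a - (ζ - circleMap 0 δ θ))⁻¹ =
        F a * (circleMap 0 δ θ * (circleMap 0 δ θ - (ζ - a))⁻¹) := by
      intro θ
      rw [mul_assoc]; congr 3; ring
    simp_rw [this]
    rw [intervalIntegral.integral_const_mul, integral_circleMap_mul_inv_sub hδ hne]
    by_cases hlt : ‖ζ - a‖ < δ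
    · rw [if_pos hlt, Set.indicator_of_mem (by rwa [mem_ball, dist_comm, dist_eq_norm])]
      ring
    · rw [if_neg hlt, Set.indicator_of_notMem (by rwa [mem_ball, dist_comm, dist_eq_norm]),
        mul_zero]
  calc ∫ z, circleMoment F δ z * (z - ζ)⁻¹
      = ∫ z : ℂ, ∫ θ, (F (z - circleMap 0 δ θ) * circleMap 0 δ θ) * (z - ζ)⁻¹ ∂ν := by
        congr 1 with z
        rw [circleMoment, intervalIntegral.integral_of_le Real.two_pi_pos.le, integral_mul_const]
    _ = ∫ θ, (∫ z : ℂ, (F (z - circleMap 0 δ θ) * circleMap 0 δ θ) * (z - ζ)⁻¹) ∂ν :=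
        integral_integral_swap h1
    _ = ∫ θ, (∫ a : ℂ, (F a * circleMap 0 δ θ) * (a - (ζ - circleMap 0 δ θ))⁻¹) ∂ν := by
        congr 1 with θ
        -- Translating by the circle point moves `θ` from the argument of `F` to the pole of the
        -- kernel.
        rw [← integral_sub_right_eq_self
          (fun a => (F a * circleMap 0 δ θ) * (a - (ζ - circleMap 0 δ θ))⁻¹) (circleMap 0 δ θ)]
        simp_rw [sub_sub_sub_cancel_right]
    _ = ∫ a : ℂ, ∫ θ, (F a * circleMap 0 δ θ) * (a - (ζ - circleMap 0 δ θ))⁻¹ ∂ν :=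
        (integral_integral_swap h2).symm
    _ = ∫ a : ℂ, (ball ζ δ).indicator (fun a => 2 * Real.pi * F a) a := by
        refine integral_congr_ae ?_
        have : ∀ᵐ a : ℂ, a ∉ sphere ζ δ :=
          measure_eq_zero_iff_ae_notMem.1 (Measure.addHaar_sphere volume ζ δ)
        filter_upwards [this] with a ha using hinner a ha
    _ = _ := by
        rw [integral_indicator measurableSet_ball, integral_const_mul]

/-- The integral of `g` along the path `c`, parametrized by `[0, 1]`. -/
noncomputable def pathIntegral (c : ℝ → ℂ) (g : ℂ → ℂ) : ℂ :=
  ∫ t in (0 : ℝ)..1, g (c t) * deriv c t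

end CircleMoments

/-! ### Winding integrals and Cauchy's theorem for Lipschitz paths. -/

section Lipschitz

open MeasureTheory Metric Complex Set
open scoped NNReal

variable {c : ℝ → ℂ} {K : ℝ≥0}

theorem intervalIntegrable_pathIntegral (hc : LipschitzWith K c) {g : ℂ → ℂ}
    (hg : ContinuousOn g (c '' Icc 0 1)) :
    IntervalIntegrable (fun t => g (c t) * deriv c t) volume 0 1 := by
  have hd : IntervalIntegrable (deriv c) volume 0 1 := by
    rw [intervalIntegrable_iff]
    refine Measure.integrableOn_of_bounded (M := K) (by simp)
      (measurable_deriv c).aestronglyMeasurable ?_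
    exact Filter.Eventually.of_forall fun t => norm_deriv_le_of_lipschitz hc
  refine hd.continuousOn_mul ?_
  rw [uIcc_of_le zero_le_one]
  exact hg.comp hc.continuous.continuousOn (mapsTo_image c _)

theorem norm_pathIntegral_le (hc : LipschitzWith K c) {g : ℂ → ℂ} {M : ℝ}
    (hM : ∀ z ∈ c '' Icc 0 1, ‖g z‖ ≤ M) : ‖pathIntegral c g‖ ≤ M * K := by
  have hM0 : 0 ≤ M := (norm_nonneg _).trans (hM (c 0) ⟨0, by simp, rfl⟩)
  refine (intervalIntegral.norm_integral_le_of_norm_le_const (C := M * K) fun t ht => ?_).trans ?_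
  · rw [uIoc_of_le zero_le_one] at ht
    rw [norm_mul]
    exact mul_le_mul (hM _ ⟨t, Ioc_subset_Icc_self ht, rfl⟩) (norm_deriv_le_of_lipschitz hc)
      (norm_nonneg _) hM0
  · simp

/-- Real and imaginary parts are Lipschitz, hence absolutely continuous, and satisfy the fundamental
theorem of calculus. -/
theorem integral_deriv_eq_sub_of_lipschitzOnWith {h : ℝ → ℂ} {a b : ℝ}
    (hh : LipschitzOnWith K h (uIcc a b)) :
    ∫ t in a..b, deriv h t = h b - h a := by
  have hre : LipschitzOnWith K (fun t => (h t).re) (uIcc a b) := by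
    refine LipschitzOnWith.of_dist_le_mul fun s hs t ht => le_trans ?_ (hh.dist_le_mul s hs t ht)
    simpa [Real.dist_eq, dist_eq_norm] using abs_re_le_norm (h s - h t)
  have him : LipschitzOnWith K (fun t => (h t).im) (uIcc a b) := by
    refine LipschitzOnWith.of_dist_le_mul fun s hs t ht => le_trans ?_ (hh.dist_le_mul s hs t ht)
    simpa [Real.dist_eq, dist_eq_norm] using abs_im_le_norm (h s - h t)
  have hrea := hre.absolutelyContinuousOnInterval
  have hima := him.absolutelyContinuousOnInterval
  have hae : ∀ᵐ t, t ∈ uIcc a b →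
      deriv h t = ((deriv (fun t => (h t).re) t : ℝ) : ℂ) + ((deriv (fun t => (h t).im) t : ℝ) : ℂ) * I := by
    filter_upwards [hrea.ae_differentiableAt, hima.ae_differentiableAt] with t h1 h2 ht
    have := ((h1 ht).hasDerivAt.ofReal_comp).add (((h2 ht).hasDerivAt.ofReal_comp).mul_const I)
    refine HasDerivAt.deriv ?_
    refine this.congr_of_eventuallyEq (Filter.Eventually.of_forall fun s => ?_)
    simp [re_add_im]
  have hirea : IntervalIntegrable (fun t => ((deriv (fun t => (h t).re) t : ℝ) : ℂ)) volume a b :=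
    ⟨hrea.intervalIntegrable_deriv.1.ofReal, hrea.intervalIntegrable_deriv.2.ofReal⟩
  have hiima : IntervalIntegrable (fun t => ((deriv (fun t => (h t).im) t : ℝ) : ℂ)) volume a b :=
    ⟨hima.intervalIntegrable_deriv.1.ofReal, hima.intervalIntegrable_deriv.2.ofReal⟩
  rw [intervalIntegral.integral_congr_ae (g := fun t =>
      ((deriv (fun t => (h t).re) t : ℝ) : ℂ) + ((deriv (fun t => (h t).im) t : ℝ) : ℂ) * I)
      (by filter_upwards [hae] with t ht h using ht (uIoc_subset_uIcc h)),
    intervalIntegral.integral_add hirea (hiima.mul_const I),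
    intervalIntegral.integral_mul_const, intervalIntegral.integral_ofReal,
    intervalIntegral.integral_ofReal, hrea.integral_deriv_eq_sub, hima.integral_deriv_eq_sub]
  apply Complex.ext <;> simp

theorem exists_pos_le_norm_sub (hc : LipschitzWith K c) {z : ℂ} (hz : z ∉ c '' Icc 0 1) :
    ∃ d > 0, ∀ t ∈ Icc (0 : ℝ) 1, d ≤ ‖c t - z‖ := by
  have hcl : IsClosed (c '' Icc 0 1) := (isCompact_Icc.image hc.continuous).isClosed
  obtain ⟨d, hd, hsub⟩ := Metric.isOpen_iff.1 hcl.isOpen_compl z hz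
  refine ⟨d, hd, fun t ht => ?_⟩
  by_contra! hlt
  exact hsub (by simpa [dist_eq_norm] using hlt : c t ∈ ball z d) ⟨t, ht, rfl⟩

theorem pathIntegral_inv_sub_sq_eq_zero (hc : LipschitzWith K c) (h01 : c 0 = c 1) {z : ℂ}
    (hz : z ∉ c '' Icc 0 1) : pathIntegral c (fun u => ((u - z) ^ 2)⁻¹) = 0 := by
  obtain ⟨d, hd, hle⟩ := exists_pos_le_norm_sub hc hz
  have hne : ∀ t ∈ Icc (0 : ℝ) 1, c t - z ≠ 0 := fun t ht =>
    norm_pos_iff.1 (hd.trans_le (hle t ht))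
  have hlip : LipschitzOnWith (K / (d.toNNReal * d.toNNReal)) (fun t => (c t - z)⁻¹)
      (uIcc 0 1) := by
    rw [uIcc_of_le zero_le_one]
    refine LipschitzOnWith.of_dist_le_mul fun s hs t ht => ?_
    rw [dist_eq_norm, inv_sub_inv (hne s hs) (hne t ht), norm_div, norm_mul]
    have h1 : ‖c t - z - (c s - z)‖ ≤ K * dist s t := by
      rw [sub_sub_sub_cancel_right, ← dist_eq_norm, dist_comm]
      exact hc.dist_le_mul s t
    calc _ ≤ (K * dist s t) / (d * d) := by
          gcongr
          · exact hle s hs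
          · exact hle t ht
      _ = _ := by simp [Real.coe_toNNReal _ hd.le]; ring
  have hft := integral_deriv_eq_sub_of_lipschitzOnWith hlip
  rw [h01, sub_self] at hft
  have : pathIntegral c (fun u => ((u - z) ^ 2)⁻¹) =
      -∫ t in (0 : ℝ)..1, deriv (fun t => (c t - z)⁻¹) t := by
    rw [pathIntegral, ← intervalIntegral.integral_neg]
    refine intervalIntegral.integral_congr_ae ?_
    filter_upwards [hc.ae_differentiableAt_real] with t hdt ht
    rw [uIoc_of_le zero_le_one] at ht
    have hn := hne t (Ioc_subset_Icc_self ht)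
    rw [((hdt.hasDerivAt.sub_const z).fun_inv hn).deriv]
    field_simp
  rw [this, hft, neg_zero]

/-- Differentiating under the integral gives the integral of `(u - z)⁻²`, which has a primitive
along the closed path. Thus the winding integral is locally constant. -/
theorem hasDerivAt_pathIntegral_inv_sub (hc : LipschitzWith K c) (h01 : c 0 = c 1) {z : ℂ}
    (hz : z ∉ c '' Icc 0 1) :
    HasDerivAt (fun z => pathIntegral c (fun u => (u - z)⁻¹)) 0 z := by
  obtain ⟨d, hd, hle⟩ := exists_pos_le_norm_sub hc hz
  have hball : ∀ x ∈ ball z (d / 2), ∀ t ∈ Icc (0 : ℝ) 1, d / 2 ≤ ‖c t - x‖ := by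
    intro x hx t ht
    have h1 := hle t ht
    have h2 : ‖x - z‖ < d / 2 := by simpa [dist_eq_norm] using hx
    have h3 : ‖c t - z‖ ≤ ‖c t - x‖ + ‖x - z‖ := norm_sub_le_norm_sub_add_norm_sub _ _ _
    linarith
  have hcm := hc.continuous.measurable
  have hdm := measurable_deriv c
  have key := intervalIntegral.hasDerivAt_integral_of_dominated_loc_of_deriv_le
    (μ := volume) (a := 0) (b := 1) (x₀ := z) (s := ball z (d / 2))
    (F := fun x t => (c t - x)⁻¹ * deriv c t)
    (F' := fun x t => ((c t - x) ^ 2)⁻¹ * deriv c t) (bound := fun _ => ((d / 2) ^ 2)⁻¹ * K)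
    (ball_mem_nhds z (by positivity))
    (Filter.Eventually.of_forall fun x => ((hcm.sub_const x).inv.mul hdm).aestronglyMeasurable)
    ?_ (((hcm.sub_const z).pow_const 2).inv.mul hdm).aestronglyMeasurable ?_ (by simp) ?_
  · have h0 := pathIntegral_inv_sub_sq_eq_zero hc h01 hz
    rw [pathIntegral] at h0
    rw [h0] at key
    exact key.2
  · refine intervalIntegrable_pathIntegral hc (g := fun u => (u - z)⁻¹) ?_
    refine ContinuousOn.inv₀ (by fun_prop) ?_
    rintro _ ⟨t, ht, rfl⟩
    exact norm_pos_iff.1 (hd.trans_le (hle t ht))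
  · refine Filter.Eventually.of_forall fun t ht x hx => ?_
    rw [uIoc_of_le zero_le_one] at ht
    rw [norm_mul, norm_inv, norm_pow]
    have := hball x hx t (Ioc_subset_Icc_self ht)
    gcongr
    exact norm_deriv_le_of_lipschitz hc
  · refine Filter.Eventually.of_forall fun t ht x hx => ?_
    rw [uIoc_of_le zero_le_one] at ht
    have := hball x hx t (Ioc_subset_Icc_self ht)
    have hn : c t - x ≠ 0 := norm_pos_iff.1 (lt_of_lt_of_le (by positivity) this)
    have h1 := (((hasDerivAt_id x).const_sub (c t)).fun_inv hn).mul_const (deriv c t)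
    simpa using h1

/-- The winding integral is constant on the component, which contains points arbitrarily far from
the path, where the integral is arbitrarily small. -/
theorem pathIntegral_inv_sub_eq_zero_of_not_isBounded (hc : LipschitzWith K c) (h01 : c 0 = c 1)
    {z : ℂ} (hz : z ∉ c '' Icc 0 1)
    (hunb : ¬ Bornology.IsBounded (connectedComponentIn (c '' Icc 0 1)ᶜ z)) :
    pathIntegral c (fun u => (u - z)⁻¹) = 0 := by
  have hcpt : IsCompact (c '' Icc 0 1) := isCompact_Icc.image hc.continuous
  have hopen : IsOpen (connectedComponentIn (c '' Icc 0 1)ᶜ z) :=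
    hcpt.isClosed.isOpen_compl.connectedComponentIn
  have hsub := connectedComponentIn_subset (c '' Icc 0 1)ᶜ z
  have hconst : ∀ y ∈ connectedComponentIn (c '' Icc 0 1)ᶜ z,
      pathIntegral c (fun u => (u - z)⁻¹) = pathIntegral c (fun u => (u - y)⁻¹) := by
    intro y hy
    have hder := fun x (hx : x ∈ connectedComponentIn (c '' Icc 0 1)ᶜ z) =>
      hasDerivAt_pathIntegral_inv_sub hc h01 (hsub hx)
    exact hopen.is_const_of_deriv_eq_zero (f := fun z => pathIntegral c (fun u => (u - z)⁻¹))
      isPreconnected_connectedComponentIn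
      (fun x hx => (hder x hx).differentiableAt.differentiableWithinAt)
      (fun x hx => (hder x hx).deriv) (mem_connectedComponentIn hz) hy
  obtain ⟨R, hR⟩ := hcpt.isBounded.exists_norm_le
  rw [isBounded_iff_forall_norm_le] at hunb
  push Not at hunb
  have hbd : ∀ N : ℝ, 0 < N → ‖pathIntegral c (fun u => (u - z)⁻¹)‖ ≤ N⁻¹ * K := by
    intro N hN
    obtain ⟨y, hy, hRy⟩ := hunb (R + N)
    rw [hconst y hy]
    refine norm_pathIntegral_le hc fun u hu => ?_
    rw [norm_inv]
    have h1 := hR u hu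
    have h2 := norm_sub_norm_le y u
    rw [norm_sub_rev] at h2
    exact inv_anti₀ hN (by linarith)
  have hlim : Filter.Tendsto (fun N : ℝ => N⁻¹ * (K : ℝ)) Filter.atTop (nhds 0) := by
    simpa using tendsto_inv_atTop_zero.mul_const (K : ℝ)
  refine norm_le_zero_iff.1 (ge_of_tendsto hlim ?_)
  filter_upwards [Filter.eventually_gt_atTop 0] with N hN using hbd N hN

/-- With `N = ⌈1/δ⌉`, discs of radius `(K + 1) δ` about the points `c(j/N)` cover the neighbourhood:
`K δ` pays for rounding the parameter, `δ` for the thickening. As `δ ≤ 1`, `(N + 1) δ ≤ 3`. -/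
theorem volume_cthickening_le (hc : LipschitzWith K c) {δ : ℝ} (hδ : 0 < δ) (hδ1 : δ ≤ 1) :
    volume (cthickening δ (c '' Icc 0 1)) ≤ ENNReal.ofReal (3 * Real.pi * (K + 1) ^ 2 * δ) := by
  set N := ⌈1 / δ⌉₊ with hN
  have hNge : 1 / δ ≤ N := Nat.le_ceil _
  have hNlt : (N : ℝ) < 1 / δ + 1 := Nat.ceil_lt_add_one (by positivity)
  have hNpos : (0 : ℝ) < N := lt_of_lt_of_le (by positivity) hNge
  have hinv : 1 / (N : ℝ) ≤ δ := by
    rw [div_le_iff₀ hNpos]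
    rw [div_le_iff₀ hδ] at hNge
    linarith
  have hcov : cthickening δ (c '' Icc 0 1) ⊆
      ⋃ j ∈ Finset.range (N + 1), closedBall (c (j / N)) ((K + 1) * δ) := by
    rw [(isCompact_Icc.image hc.continuous).cthickening_eq_biUnion_closedBall hδ.le]
    intro x hx
    simp only [mem_iUnion, exists_prop] at hx
    obtain ⟨_, ⟨t, ht, rfl⟩, hx⟩ := hx
    have hj : ⌊t * N⌋₊ ≤ N := by
      refine Nat.floor_le_of_le ?_
      exact mul_le_of_le_one_left hNpos.le ht.2
    simp only [mem_iUnion, exists_prop]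
    refine ⟨⌊t * N⌋₊, Finset.mem_range.2 (by omega), ?_⟩
    have h1 : |t - (⌊t * N⌋₊ : ℝ) / N| ≤ δ := by
      have ha := Nat.floor_le (mul_nonneg ht.1 hNpos.le)
      have hb := Nat.lt_floor_add_one (t * N)
      refine le_trans ?_ hinv
      rw [show t - (⌊t * N⌋₊ : ℝ) / N = (t * N - ⌊t * N⌋₊) / N by field_simp, abs_div,
        abs_of_pos hNpos]
      gcongr
      rw [abs_le]; constructor <;> linarith
    have h2 := hc.dist_le_mul t ((⌊t * N⌋₊ : ℝ) / N)
    rw [Real.dist_eq] at h2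
    rw [mem_closedBall] at hx ⊢
    calc _ ≤ _ := dist_triangle _ (c t) _
      _ ≤ δ + K * δ := add_le_add hx (h2.trans (by gcongr))
      _ = _ := by ring
  calc volume (cthickening δ (c '' Icc 0 1))
      ≤ ∑ j ∈ Finset.range (N + 1), volume (closedBall (c (j / N)) ((K + 1) * δ)) :=
        (measure_mono hcov).trans (measure_biUnion_finset_le _ _)
    _ = (N + 1 : ℕ) * (ENNReal.ofReal ((K + 1) * δ) ^ 2 * NNReal.pi) := by
        simp only [Complex.volume_closedBall, Finset.sum_const, Finset.card_range, nsmul_eq_mul]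
    _ = ENNReal.ofReal ((N + 1) * (((K + 1) * δ) ^ 2 * Real.pi)) := by
        have hr : 0 ≤ (K + 1) * δ := by positivity
        generalize ((K : ℝ) + 1) * δ = r at hr
        rw [ENNReal.ofReal_mul (by positivity), ENNReal.ofReal_mul (by positivity),
          ENNReal.ofReal_pow hr, ← NNReal.coe_real_pi, ENNReal.ofReal_coe_nnreal,
          ← Nat.cast_succ, ENNReal.ofReal_natCast]
    _ ≤ _ := by
        refine ENNReal.ofReal_le_ofReal ?_
        have h3 : (N + 1) * δ ≤ 3 := by
          have : (N + 1 : ℝ) * δ ≤ (1 / δ + 2) * δ :=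
            mul_le_mul_of_nonneg_right (by linarith) hδ.le
          have h4 : (1 / δ + 2) * δ = 1 + 2 * δ := by field_simp
          linarith
        calc (N + 1) * (((K + 1) * δ) ^ 2 * Real.pi)
            = ((N + 1) * δ) * (Real.pi * (K + 1) ^ 2 * δ) := by ring
          _ ≤ 3 * (Real.pi * (K + 1) ^ 2 * δ) := by gcongr
          _ = _ := by ring

theorem volume_image_Icc_eq_zero (hc : LipschitzWith K c) : volume (c '' Icc (0 : ℝ) 1) = 0 := by
  have hlim : Filter.Tendsto (fun δ : ℝ => ENNReal.ofReal (3 * Real.pi * (K + 1) ^ 2 * δ))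
      (nhdsWithin 0 (Ioi 0)) (nhds 0) := by
    have : Filter.Tendsto (fun δ : ℝ => ENNReal.ofReal (3 * Real.pi * (K + 1) ^ 2 * δ))
      (nhds 0) (nhds (ENNReal.ofReal (3 * Real.pi * (K + 1) ^ 2 * 0))) :=
      (ENNReal.continuous_ofReal.comp (by fun_prop)).tendsto _
    simp only [mul_zero, ENNReal.ofReal_zero] at this
    exact this.mono_left nhdsWithin_le_nhds
  refine le_antisymm (ge_of_tendsto hlim ?_) zero_le
  filter_upwards [Ioc_mem_nhdsGT (zero_lt_one' ℝ)] with δ hδ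
  exact (measure_mono (self_subset_cthickening _)).trans (volume_cthickening_le hc hδ.1 hδ.2)

theorem integrable_mul_deriv_mul_cauchyKernel (hc : LipschitzWith K c) {D : ℂ → ℂ}
    (hD : Continuous D) {M R : ℝ} (hM : ∀ z, ‖D z‖ ≤ M) (hR : ∀ z, R < ‖z‖ → D z = 0) :
    Integrable (fun p : ℂ × ℝ => D p.1 * deriv c p.2 * (p.1 - c p.2)⁻¹)
      (volume.prod (volume.restrict (Ioc 0 1))) := by
  have hM0 : 0 ≤ M := (norm_nonneg _).trans (hM 0)
  refine integrable_mul_cauchyKernel hc.continuous.measurable (M := M * K) (R := R)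
    ((hD.measurable.comp measurable_fst).mul ((measurable_deriv c).comp measurable_snd)) ?_ ?_
  · intro p
    rw [norm_mul]
    exact mul_le_mul (hM _) (norm_deriv_le_of_lipschitz hc) (norm_nonneg _) hM0
  · intro p hp
    rw [hR _ hp, zero_mul]

theorem pathIntegral_cauchyTransform (hc : LipschitzWith K c) {D : ℂ → ℂ}
    (hD : Continuous D) {M R : ℝ} (hM : ∀ z, ‖D z‖ ≤ M) (hR : ∀ z, R < ‖z‖ → D z = 0) :
    pathIntegral c (fun ζ => ∫ z, D z * (z - ζ)⁻¹) =
      -∫ z, D z * pathIntegral c (fun ζ => (ζ - z)⁻¹) := by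
  have hint := integrable_mul_deriv_mul_cauchyKernel hc hD hM hR
  calc pathIntegral c (fun ζ => ∫ z, D z * (z - ζ)⁻¹)
      = ∫ t in Ioc (0 : ℝ) 1, (∫ z : ℂ, D z * deriv c t * (z - c t)⁻¹) := by
        rw [pathIntegral, intervalIntegral.integral_of_le zero_le_one]
        congr 1 with t
        rw [← integral_mul_const]
        congr 1 with z
        ring
    _ = ∫ z : ℂ, ∫ t in Ioc (0 : ℝ) 1, D z * deriv c t * (z - c t)⁻¹ :=
        (integral_integral_swap hint).symm
    _ = _ := by
        rw [← integral_neg]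
        congr 1 with z
        rw [pathIntegral, intervalIntegral.integral_of_le zero_le_one, ← integral_const_mul,
          ← integral_neg]
        congr 1 with t
        rw [← neg_sub (c t) z, inv_neg]
        ring

/-- Cauchy's theorem for a closed Lipschitz path whose winding number vanishes off an open set `U`
in which the integrand is holomorphic, with an integrand that is merely continuous elsewhere. -/
theorem pathIntegral_eq_zero_of_winding (hc : LipschitzWith K c) {U : Set ℂ} (hU : IsOpen U)
    (hW : ∀ z ∉ c '' Icc 0 1, ‖pathIntegral c (fun ζ => (ζ - z)⁻¹)‖ ≤ 2 * Real.pi)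
    (hW0 : ∀ z ∉ c '' Icc 0 1, z ∉ U → pathIntegral c (fun ζ => (ζ - z)⁻¹) = 0)
    (hfar : ∀ z ∈ U, ∀ δ, z ∉ cthickening δ (c '' Icc 0 1) → closedBall z δ ⊆ U)
    {F : ℂ → ℂ} (hF : Continuous F) (hFs : HasCompactSupport F) (hFU : DifferentiableOn ℂ F U) :
    pathIntegral c F = 0 := by
  obtain ⟨M, hM⟩ := hF.bounded_above_of_compact_support hFs
  obtain ⟨R, hR⟩ : ∃ R, ∀ z, R < ‖z‖ → F z = 0 := by
    obtain ⟨R, hR⟩ := hFs.isCompact.isBounded.exists_norm_le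
    exact ⟨R, fun z hz => image_eq_zero_of_notMem_tsupport fun h => hz.not_ge (hR z h)⟩
  have hUC := hFs.uniformContinuous_of_continuous hF
  set C : ℝ := 3 * Real.pi * (K + 1) ^ 2 with hC
  have hC0 : 0 ≤ C := by positivity
  have key : ∀ ε > 0, ‖pathIntegral c F‖ ≤ ε * (K + 2 * C) := by
    intro ε hε
    obtain ⟨δ', hδ', hosc'⟩ := Metric.uniformContinuous_iff.1 hUC ε hε
    set δ := min (δ' / 2) 1 with hδdef
    have hδ : 0 < δ := by positivity
    have hδ1 : δ ≤ 1 := min_le_right _ _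
    have hosc : ∀ x y : ℂ, ‖x - y‖ ≤ δ → ‖F x - F y‖ ≤ ε := by
      intro x y hxy
      rw [← dist_eq_norm] at hxy ⊢
      refine (hosc' (hxy.trans_lt ?_)).le
      exact (min_le_left _ _).trans_lt (by linarith)
    set D := circleMoment F δ with hD
    have hDc : Continuous D := continuous_circleMoment hF δ
    have hDM : ∀ z, ‖D z‖ ≤ 2 * Real.pi * δ * ε := norm_circleMoment_le hF hδ.le hosc
    have hDR : ∀ z, R + δ < ‖z‖ → D z = 0 := fun z hz =>
      circleMoment_eq_zero_of_lt_norm hδ.le hR hz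
    have hdisc : ∀ ζ, ∫ a in ball ζ δ, F a = (2 * Real.pi : ℂ)⁻¹ * ∫ z, D z * (z - ζ)⁻¹ := by
      intro ζ
      have hpi : (2 * Real.pi : ℂ) ≠ 0 := by simp [Real.pi_ne_zero]
      rw [integral_circleMoment_mul_cauchyKernel hF hδ hM hR, inv_mul_cancel_left₀ hpi]
    have hvol := volume_cthickening_le hc hδ hδ1
    have hvolr : volume.real (cthickening δ (c '' Icc 0 1)) ≤ C * δ :=
      ENNReal.toReal_le_of_le_ofReal (by positivity) hvol
    -- Away from the neighbourhood of the path one factor vanishes: in `U` the circle moment, since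
    -- the whole disc lies in `U`; off `U` the winding integral.
    have hDW : ‖∫ z, D z * pathIntegral c (fun ζ => (ζ - z)⁻¹)‖ ≤
        (2 * Real.pi * δ * ε) * (2 * Real.pi) * (C * δ) := by
      have hms : MeasurableSet (cthickening δ (c '' Icc 0 1)) :=
        isClosed_cthickening.measurableSet
      refine (norm_integral_le_of_norm_le
        (g := (cthickening δ (c '' Icc 0 1)).indicator
          fun _ => (2 * Real.pi * δ * ε) * (2 * Real.pi)) ?_ ?_).trans ?_
      · exact (integrable_indicator_iff hms).2
          (integrableOn_const (hvol.trans_lt ENNReal.ofReal_lt_top).ne)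
      · filter_upwards [measure_eq_zero_iff_ae_notMem.1 (volume_image_Icc_eq_zero hc)] with z hz
        by_cases hzt : z ∈ cthickening δ (c '' Icc 0 1)
        · rw [indicator_of_mem hzt, norm_mul]
          exact mul_le_mul (hDM z) (hW z hz) (norm_nonneg _) (by positivity)
        · rw [indicator_of_notMem hzt]
          by_cases hzU : z ∈ U
          · rw [hD, circleMoment_eq_zero_of_differentiableOn hU hFU hδ.le (hfar z hzU δ hzt)]
            simp
          · rw [hW0 z hz hzU]; simp
      · rw [integral_indicator hms, setIntegral_const, smul_eq_mul, mul_comm]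
        gcongr
    have hA : ‖pathIntegral c (fun ζ => ∫ a in ball ζ δ, F a)‖ ≤ 2 * Real.pi * C * δ ^ 2 * ε := by
      have : pathIntegral c (fun ζ => ∫ a in ball ζ δ, F a) =
          (2 * Real.pi : ℂ)⁻¹ * -∫ z, D z * pathIntegral c (fun ζ => (ζ - z)⁻¹) := by
        rw [← pathIntegral_cauchyTransform hc hDc hDM hDR]
        simp_rw [pathIntegral, hdisc, mul_assoc]
        rw [intervalIntegral.integral_const_mul]
      rw [this, norm_mul, norm_neg, norm_inv]
      have h2pi : ‖(2 * Real.pi : ℂ)‖ = 2 * Real.pi := by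
        simp [abs_of_pos Real.pi_pos]
      rw [h2pi, inv_mul_le_iff₀ Real.two_pi_pos]
      refine hDW.trans (le_of_eq (by ring))
    have hAi : IntervalIntegrable (fun t => (∫ a in ball (c t) δ, F a) * deriv c t) volume 0 1 := by
      rw [intervalIntegrable_iff, uIoc_of_le zero_le_one]
      have h1 := (integrable_mul_deriv_mul_cauchyKernel hc hDc hDM hDR).integral_prod_right
      refine (h1.const_mul (2 * Real.pi : ℂ)⁻¹).congr (Filter.Eventually.of_forall fun t => ?_)
      simp only [hdisc]
      rw [mul_assoc, ← integral_mul_const]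
      congr 2 with z
      ring
    have hvb : ∀ ζ : ℂ, volume.real (ball ζ δ) = Real.pi * δ ^ 2 := by
      intro ζ
      simp [Measure.real, Complex.volume_ball, hδ.le, mul_comm]
    have hdiff : ∀ ζ, ‖(Real.pi * δ ^ 2 : ℂ) * F ζ - ∫ a in ball ζ δ, F a‖ ≤
        ε * (Real.pi * δ ^ 2) := by
      intro ζ
      have h1 : (Real.pi * δ ^ 2 : ℂ) * F ζ = ∫ a in ball ζ δ, F ζ := by
        rw [setIntegral_const, hvb, real_smul]; push_cast; ring
      rw [h1, ← integral_sub, ← hvb ζ]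
      · refine norm_setIntegral_le_of_norm_le_const measure_ball_lt_top fun a ha => ?_
        refine hosc _ _ ?_
        rw [← dist_eq_norm, dist_comm]
        exact (mem_ball.1 ha).le
      · exact integrableOn_const measure_ball_lt_top.ne
      · exact (hF.integrable_of_hasCompactSupport hFs).integrableOn
    -- The first term is small because `F` oscillates by at most `ε` on each disc, the second by the
    -- area estimate; both are `O(δ² ε)`.
    have hsplit : (Real.pi * δ ^ 2 : ℂ) * pathIntegral c F =
        pathIntegral c (fun ζ => (Real.pi * δ ^ 2 : ℂ) * F ζ - ∫ a in ball ζ δ, F a) +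
          pathIntegral c (fun ζ => ∫ a in ball ζ δ, F a) := by
      simp_rw [pathIntegral, sub_mul, mul_assoc]
      rw [intervalIntegral.integral_sub _ hAi, intervalIntegral.integral_const_mul,
        intervalIntegral.integral_const_mul, sub_add_cancel]
      exact ((intervalIntegrable_pathIntegral hc hF.continuousOn).const_mul _).const_mul _
    have hpos : 0 < Real.pi * δ ^ 2 := by positivity
    have hnorm : ‖(Real.pi * δ ^ 2 : ℂ)‖ = Real.pi * δ ^ 2 := by
      simp [abs_of_pos Real.pi_pos]
    have hfin : Real.pi * δ ^ 2 * ‖pathIntegral c F‖ ≤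
        Real.pi * δ ^ 2 * (ε * (K + 2 * C)) := by
      rw [← hnorm, ← norm_mul, hsplit, hnorm]
      refine (norm_add_le _ _).trans ?_
      refine (add_le_add (norm_pathIntegral_le hc fun z _ => hdiff z) hA).trans ?_
      exact le_of_eq (by ring)
    exact le_of_mul_le_mul_left hfin hpos
  have hlim : Filter.Tendsto (fun ε : ℝ => ε * (K + 2 * C)) (nhdsWithin 0 (Ioi 0)) (nhds 0) := by
    have : Filter.Tendsto (fun ε : ℝ => ε * (K + 2 * C)) (nhds 0) (nhds (0 * (K + 2 * C))) :=
      Continuous.tendsto (by fun_prop) _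
    rw [zero_mul] at this
    exact this.mono_left nhdsWithin_le_nhds
  refine norm_le_zero_iff.1 (ge_of_tendsto hlim ?_)
  filter_upwards [self_mem_nhdsWithin] with ε hε using key ε hε

end Lipschitz

/-! ### Topology of Jordan curves; Cauchy's theorem and integral formula on them. -/

namespace Curve

open MeasureTheory Metric Complex Set
open scoped NNReal

/-- The parametrization of `γ`, extended from `[0, 1]` to `ℝ` by constants. -/
noncomputable def path (γ : Curve) : ℝ → ℂ :=
  fun t => γ.toFun (projIcc (0 : ℝ) 1 zero_le_one t)

variable (γ : Curve)

theorem path_of_mem {t : ℝ} (ht : t ∈ Icc (0 : ℝ) 1) : γ.path t = γ.toFun t := by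
  rw [path, projIcc_of_mem _ ht]

theorem exists_lipschitzWith_path : ∃ K, LipschitzWith K γ.path := by
  obtain ⟨K, hK⟩ := γ.lipschitz
  refine ⟨K * 1, ?_⟩
  exact (hK.to_restrict).comp (LipschitzWith.projIcc zero_le_one)

theorem path_zero_eq_path_one : γ.path 0 = γ.path 1 := by
  rw [path_of_mem γ (by simp), path_of_mem γ (by simp), γ.closed]

theorem image_path : γ.path '' Icc 0 1 = γ.trace :=
  image_congr fun _ ht => path_of_mem γ ht

theorem deriv_path {t : ℝ} (ht : t ∈ Ioo (0 : ℝ) 1) : deriv γ.path t = deriv γ.toFun t := by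
  refine Filter.EventuallyEq.deriv_eq ?_
  filter_upwards [Icc_mem_nhds ht.1 ht.2] with s hs using path_of_mem γ hs

/-- The derivatives of the curve and of its constant extension may differ at the endpoints, a null
set. -/
theorem pathIntegral_path (g : ℂ → ℂ) :
    pathIntegral γ.path g = ∫ t in (0 : ℝ)..1, g (γ.toFun t) * deriv γ.toFun t := by
  rw [pathIntegral, intervalIntegral.integral_of_le zero_le_one,
    intervalIntegral.integral_of_le zero_le_one, integral_Ioc_eq_integral_Ioo,
    integral_Ioc_eq_integral_Ioo]
  refine setIntegral_congr_fun measurableSet_Ioo fun t ht => ?_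
  simp only [deriv_path γ ht, path_of_mem γ (Ioo_subset_Icc_self ht)]

theorem isCompact_trace : IsCompact γ.trace := by
  obtain ⟨K, hK⟩ := γ.exists_lipschitzWith_path
  rw [← image_path]
  exact isCompact_Icc.image hK.continuous

theorem connectedComponentIn_subset_inside {z : ℂ} (hz : z ∈ γ.inside) :
    connectedComponentIn γ.traceᶜ z ⊆ γ.inside := by
  intro y hy
  refine ⟨connectedComponentIn_subset _ _ hy, ?_⟩
  rw [← connectedComponentIn_eq hy]
  exact hz.2

theorem isOpen_inside : IsOpen γ.inside := by
  refine isOpen_iff_mem_nhds.2 fun z hz => ?_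
  exact Filter.mem_of_superset
    (γ.isCompact_trace.isClosed.isOpen_compl.connectedComponentIn.mem_nhds
      (mem_connectedComponentIn hz.1)) (γ.connectedComponentIn_subset_inside hz)

/-- The complement is a union of unbounded components of the complement of the trace, and these are
open. -/
theorem isClosed_inside_union_trace : IsClosed (γ.inside ∪ γ.trace) := by
  refine isOpen_compl_iff.1 (isOpen_iff_mem_nhds.2 fun z hz => ?_)
  rw [mem_compl_iff, mem_union, not_or] at hz
  refine Filter.mem_of_superset
    (γ.isCompact_trace.isClosed.isOpen_compl.connectedComponentIn.mem_nhds
      (mem_connectedComponentIn hz.2)) fun y hy => ?_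
  rw [mem_compl_iff, mem_union, not_or]
  refine ⟨fun h => hz.1 ⟨hz.2, ?_⟩, connectedComponentIn_subset _ _ hy⟩
  rw [connectedComponentIn_eq hy]
  exact h.2

theorem isCompact_inside_union_trace : IsCompact (γ.inside ∪ γ.trace) := by
  refine isCompact_of_isClosed_isBounded γ.isClosed_inside_union_trace ?_
  obtain ⟨R, hR⟩ := γ.isCompact_trace.isBounded.exists_norm_le
  have hR0 : 0 ≤ R := (norm_nonneg _).trans (hR (γ.toFun 0) ⟨0, by simp, rfl⟩)
  refine isBounded_iff_forall_norm_le.2 ⟨R, ?_⟩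
  rintro z (hz | hz)
  · by_contra! hlt
    obtain ⟨M, hM⟩ := isBounded_iff_forall_norm_le.1 hz.2
    -- A point farther out than the whole trace sees infinity along a radial ray, so its component
    -- is unbounded.
    have hray : (fun s : ℝ => (s : ℂ) * z) '' Ici 1 ⊆ connectedComponentIn γ.traceᶜ z := by
      refine IsPreconnected.subset_connectedComponentIn
        (isPreconnected_Ici.image _ (by fun_prop)) ⟨1, by simp, by simp⟩ ?_
      rintro _ ⟨s, hs, rfl⟩ hmem
      have h1 := hR _ hmem
      have hs1 : (1 : ℝ) ≤ s := hs
      rw [norm_mul, norm_real, Real.norm_eq_abs, abs_of_pos (by linarith)] at h1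
      nlinarith
    have hz0 : 0 < ‖z‖ := hR0.trans_lt hlt
    have h2 := hM _ (hray ⟨max 1 ((M + 1) / ‖z‖), mem_Ici.2 (le_max_left _ _), rfl⟩)
    rw [norm_mul, norm_real, Real.norm_eq_abs, abs_of_pos (lt_max_of_lt_left one_pos)] at h2
    have h3 : (M + 1) / ‖z‖ * ‖z‖ ≤ max 1 ((M + 1) / ‖z‖) * ‖z‖ := by
      gcongr; exact le_max_right _ _
    rw [div_mul_cancel₀ _ hz0.ne'] at h3
    linarith
  · exact hR z hz

theorem closedBall_subset_inside {z : ℂ} (hz : z ∈ γ.inside) {δ : ℝ}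
    (hδ : z ∉ cthickening δ γ.trace) : closedBall z δ ⊆ γ.inside := by
  rcases lt_or_ge δ 0 with h | h
  · simp [closedBall_eq_empty.2 h]
  refine subset_trans ?_ (γ.connectedComponentIn_subset_inside hz)
  refine IsPreconnected.subset_connectedComponentIn (convex_closedBall z δ).isPreconnected
    (mem_closedBall_self h) fun y hy hyt => hδ ?_
  exact mem_cthickening_of_dist_le z y δ _ hyt (by rwa [dist_comm])

theorem pathIntegral_inv_sub_of_mem_inside {z : ℂ} (hz : z ∈ γ.inside) :
    pathIntegral γ.path (fun ζ => (ζ - z)⁻¹) = 2 * Real.pi * I := by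
  have h := γ.positive z hz.1 hz.2
  rw [pathIntegral_path]
  simp_rw [div_eq_inv_mul] at h
  exact ((inv_mul_eq_one₀ (by simp [Real.pi_ne_zero])).1 h).symm

theorem pathIntegral_inv_sub_of_notMem {z : ℂ} (hz : z ∉ γ.trace) (hzi : z ∉ γ.inside) :
    pathIntegral γ.path (fun ζ => (ζ - z)⁻¹) = 0 := by
  obtain ⟨K, hK⟩ := γ.exists_lipschitzWith_path
  refine pathIntegral_inv_sub_eq_zero_of_not_isBounded hK γ.path_zero_eq_path_one
    (by rwa [image_path]) ?_
  rw [image_path]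
  exact fun h => hzi ⟨hz, h⟩

/-- Cauchy's theorem for a function holomorphic inside a rectifiable simple closed curve and
continuous up to the curve. -/
theorem pathIntegral_eq_zero {g : ℂ → ℂ} (hg : ContinuousOn g (γ.inside ∪ γ.trace))
    (hd : DifferentiableOn ℂ g γ.inside) : pathIntegral γ.path g = 0 := by
  obtain ⟨K, hK⟩ := γ.exists_lipschitzWith_path
  -- Tietze extension, followed by a cutoff equal to `1` on the closed region; no holomorphy is
  -- needed outside.
  obtain ⟨G, hG⟩ := ContinuousMap.exists_restrict_eq γ.isClosed_inside_union_trace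
    ⟨(γ.inside ∪ γ.trace).domRestrict g, hg.domRestrict⟩
  obtain ⟨χ, hχ1, -, hχs, -⟩ := exists_continuous_one_zero_of_isCompact
    γ.isCompact_inside_union_trace isClosed_empty (disjoint_empty _)
  set F : ℂ → ℂ := fun z => (χ z : ℂ) * G z with hFdef
  have hFg : EqOn F g (γ.inside ∪ γ.trace) := by
    intro z hz
    have h1 : G z = g z := congrArg (fun φ => φ ⟨z, hz⟩) hG
    simp [hFdef, hχ1 hz, h1]
  have hF : Continuous F := by fun_prop
  have hFs : HasCompactSupport F := by
    refine HasCompactSupport.mul_right ?_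
    exact hχs.comp_left (g := fun x : ℝ => (x : ℂ)) (by simp)
  have hFz : pathIntegral γ.path F = 0 := by
    refine pathIntegral_eq_zero_of_winding hK γ.isOpen_inside ?_ ?_ ?_ hF hFs
      (hd.congr fun z hz => hFg (Or.inl hz))
    · intro z hz
      rw [image_path] at hz
      by_cases hzi : z ∈ γ.inside
      · rw [γ.pathIntegral_inv_sub_of_mem_inside hzi]
        simp [abs_of_pos Real.pi_pos]
      · rw [γ.pathIntegral_inv_sub_of_notMem hz hzi, norm_zero]
        positivity
    · intro z hz hzi
      rw [image_path] at hz
      exact γ.pathIntegral_inv_sub_of_notMem hz hzi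
    · intro z hz δ hδ
      rw [image_path] at hδ
      exact γ.closedBall_subset_inside hz hδ
  rw [← hFz]
  refine intervalIntegral.integral_congr fun t ht => ?_
  rw [uIcc_of_le zero_le_one] at ht
  have : γ.path t ∈ γ.trace := by rw [← image_path]; exact ⟨t, ht, rfl⟩
  simp only [hFg (Or.inr this)]

theorem pathIntegral_mul_inv_sub_of_notMem {f : ℂ → ℂ}
    (hf : ContinuousOn f (γ.inside ∪ γ.trace)) (hd : DifferentiableOn ℂ f γ.inside) {a : ℂ}
    (ha : a ∉ γ.trace) (hai : a ∉ γ.inside) :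
    pathIntegral γ.path (fun ζ => f ζ * (ζ - a)⁻¹) = 0 := by
  have hne : ∀ z ∈ γ.inside ∪ γ.trace, z - a ≠ 0 := by
    rintro z hz h
    rw [sub_eq_zero] at h
    subst h
    exact hz.elim hai ha
  refine γ.pathIntegral_eq_zero (hf.mul (ContinuousOn.inv₀ (by fun_prop) hne)) ?_
  exact hd.mul (DifferentiableOn.fun_inv (by fun_prop) fun z hz => hne z (Or.inl hz))

/-- Cauchy's integral formula for a function holomorphic inside a rectifiable simple closed curve
and continuous up to the curve. -/
theorem pathIntegral_mul_inv_sub_of_mem_inside {f : ℂ → ℂ}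
    (hf : ContinuousOn f (γ.inside ∪ γ.trace)) (hd : DifferentiableOn ℂ f γ.inside) {a : ℂ}
    (ha : a ∈ γ.inside) :
    pathIntegral γ.path (fun ζ => f ζ * (ζ - a)⁻¹) = 2 * Real.pi * I * f a := by
  obtain ⟨K, hK⟩ := γ.exists_lipschitzWith_path
  have hnhds : γ.inside ∈ nhds a := γ.isOpen_inside.mem_nhds ha
  -- The difference quotient, with value `f' a` at `a`, is holomorphic inside, so Cauchy's theorem
  -- applies to it.
  have hzero : pathIntegral γ.path (dslope f a) = 0 := by
    refine γ.pathIntegral_eq_zero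
      ((continuousOn_dslope (Filter.mem_of_superset hnhds subset_union_left)).2
        ⟨hf, hd.differentiableAt hnhds⟩) ((differentiableOn_dslope hnhds).2 hd)
  have hne : ∀ z ∈ γ.path '' Icc 0 1, z - a ≠ 0 := by
    rw [image_path]
    rintro z hz h
    rw [sub_eq_zero] at h
    subst h
    exact ha.1 hz
  have hinv : ContinuousOn (fun ζ : ℂ => (ζ - a)⁻¹) (γ.path '' Icc 0 1) :=
    ContinuousOn.inv₀ (by fun_prop) hne
  have hf' : ContinuousOn f (γ.path '' Icc 0 1) := by
    rw [image_path]; exact hf.mono subset_union_right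
  have hsplit : pathIntegral γ.path (fun ζ => f ζ * (ζ - a)⁻¹) =
      pathIntegral γ.path (dslope f a) +
        f a * pathIntegral γ.path (fun ζ => (ζ - a)⁻¹) := by
    have h1 : pathIntegral γ.path (dslope f a) =
        pathIntegral γ.path (fun ζ => f ζ * (ζ - a)⁻¹ - f a * (ζ - a)⁻¹) := by
      refine intervalIntegral.integral_congr fun t ht => ?_
      rw [uIcc_of_le zero_le_one] at ht
      have := hne _ ⟨t, ht, rfl⟩
      simp only [dslope_of_ne f (sub_ne_zero.1 this), slope_def_field]
      ring
    rw [h1]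
    simp_rw [pathIntegral, sub_mul, mul_assoc]
    rw [intervalIntegral.integral_sub, intervalIntegral.integral_const_mul, sub_add_cancel]
    · simpa only [Pi.mul_apply, mul_assoc] using intervalIntegrable_pathIntegral hK (hf'.mul hinv)
    · exact (intervalIntegrable_pathIntegral hK hinv).const_mul _
  rw [hsplit, hzero, zero_add, γ.pathIntegral_inv_sub_of_mem_inside ha]
  ring

end Curve

open MeasureTheory Complex in
theorem sum_pathIntegral_mul_inv_sub {m : ℕ} {Γ : Fin m → Curve} {f : ℂ → ℂ}
    (hf : ∀ i, ContinuousOn f ((Γ i).inside ∪ (Γ i).trace))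
    (hd : ∀ i, DifferentiableOn ℂ f (Γ i).inside) {a : ℂ} (ha : Encloses Γ a) :
    ∑ i, pathIntegral (Γ i).path (fun ζ => f ζ * (ζ - a)⁻¹) = 2 * Real.pi * I * f a := by
  obtain ⟨hat, i, hi, huniq⟩ := ha
  rw [Finset.sum_eq_single i]
  · exact (Γ i).pathIntegral_mul_inv_sub_of_mem_inside (hf i) (hd i) hi
  · intro j _ hj
    exact (Γ j).pathIntegral_mul_inv_sub_of_notMem (hf j) (hd j) (hat j)
      fun h => hj (huniq j h)
  · simp

/-! ### Full block Krylov dimension makes `T` Hermitian. -/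

variable {n b k : ℕ} {H : Matrix (Fin n) (Fin n) ℂ} {V : Matrix (Fin n) (Fin b) ℂ}
  {Q : ℕ → Matrix (Fin n) (Fin b) ℂ} {A B : ℕ → Matrix (Fin b) (Fin b) ℂ}

theorem krylov_mono {i j : ℕ} (h : i ≤ j) : krylov H V i ≤ krylov H V j := by
  refine Submodule.span_mono ?_
  rintro v ⟨l, hl, q, rfl⟩
  exact ⟨l, hl.trans_le h, q, rfl⟩

theorem mulVec_eq_sum_smul_col {m n : Type*} [Fintype n] (M : Matrix m n ℂ) (y : n → ℂ) :
    M *ᵥ y = ∑ q, y q • fun r => M r q := by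
  ext r
  simp [mulVec, dotProduct, mul_comm]

theorem pow_mul_mulVec_mem_krylov {i j : ℕ} (h : i < j) (y : Fin b → ℂ) :
    (H ^ i * V) *ᵥ y ∈ krylov H V j := by
  rw [mulVec_eq_sum_smul_col]
  exact Submodule.sum_mem _ fun q _ =>
    Submodule.smul_mem _ _ (Submodule.subset_span ⟨i, h, q, rfl⟩)

theorem mulVec_mem_krylov_succ {j : ℕ} {v : Fin n → ℂ} (hv : v ∈ krylov H V j) :
    H *ᵥ v ∈ krylov H V (j + 1) := by
  have : krylov H V j ≤ (krylov H V (j + 1)).comap H.mulVecLin := by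
    refine Submodule.span_le.2 ?_
    rintro v ⟨i, hi, q, rfl⟩
    have hcol : H *ᵥ (fun r => (H ^ i * V) r q) = fun r => (H ^ (i + 1) * V) r q := by
      ext r
      rw [pow_succ', Matrix.mul_assoc, Matrix.mul_apply]
      rfl
    simp only [Submodule.comap_coe, Set.mem_preimage, mulVecLin_apply, SetLike.mem_coe, hcol]
    exact Submodule.subset_span ⟨i + 1, by omega, q, rfl⟩
  exact this hv

/-- The `(k + 1) b` columns of `V, …, H ^ k V` span a space of that dimension, hence are linearly
independent. -/
theorem eq_zero_of_pow_mul_mulVec_mem_krylov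
    (hdim : Module.finrank ℂ (krylov H V (k + 1)) = (k + 1) * b) {j : ℕ} (hj : j ≤ k)
    {y : Fin b → ℂ} (hy : (H ^ j * V) *ᵥ y ∈ krylov H V j) : y = 0 := by
  set φ : Fin (k + 1) × Fin b → (Fin n → ℂ) := fun x r => (H ^ (x.1 : ℕ) * V) r x.2 with hφ
  have hrange : krylov H V (k + 1) = Submodule.span ℂ (Set.range φ) := by
    refine congrArg _ (Set.ext fun v => ⟨?_, ?_⟩)
    · rintro ⟨i, hi, q, rfl⟩
      exact ⟨(⟨i, hi⟩, q), rfl⟩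
    · rintro ⟨⟨i, q⟩, rfl⟩
      exact ⟨i, i.2, q, rfl⟩
  have hli : LinearIndependent ℂ φ := by
    rw [linearIndependent_iff_card_eq_finrank_span, Set.finrank, ← hrange, hdim]
    simp
  have hjlt : j < k + 1 := by omega
  have hsub : krylov H V j ≤ Submodule.span ℂ (φ '' {x | (x.1 : ℕ) < j}) := by
    refine Submodule.span_mono ?_
    rintro v ⟨i, hi, q, rfl⟩
    exact ⟨(⟨i, by omega⟩, q), hi, rfl⟩
  have hsum : (H ^ j * V) *ᵥ y = ∑ q, y q • φ (⟨j, hjlt⟩, q) := mulVec_eq_sum_smul_col _ _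
  have hmem : (H ^ j * V) *ᵥ y ∈ Submodule.span ℂ (φ '' {x | (x.1 : ℕ) = j}) := by
    rw [hsum]
    exact Submodule.sum_mem _ fun q _ => Submodule.smul_mem _ _
      (Submodule.subset_span ⟨(⟨j, hjlt⟩, q), rfl, rfl⟩)
  have hdisj : Disjoint {x : Fin (k + 1) × Fin b | (x.1 : ℕ) < j} {x | (x.1 : ℕ) = j} :=
    Set.disjoint_left.2 fun x h1 h2 => (ne_of_lt (show (x.1 : ℕ) < j from h1)) h2
  have hzero := Submodule.disjoint_def.1 (hli.disjoint_span_image hdisj) _ (hsub hy) hmem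
  rw [hsum] at hzero
  have hinj : Function.Injective fun q : Fin b => ((⟨j, hjlt⟩ : Fin (k + 1)), q) :=
    fun p q h => (Prod.mk.inj h).2
  ext q
  exact Fintype.linearIndependent_iff.1 (hli.comp _ hinj) y hzero q

/-- The product `B_{j-1} ⋯ B_0`. -/
noncomputable def prodB (B : ℕ → Matrix (Fin b) (Fin b) ℂ) : ℕ → Matrix (Fin b) (Fin b) ℂ
  | 0 => 1
  | j + 1 => B j * prodB B j

theorem isUnit_prodB {j : ℕ} (h : ∀ i < j, IsUnit (B i)) : IsUnit (prodB B j) := by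
  induction j with
  | zero => exact isUnit_one
  | succ j ih => exact (h j (by omega)).mul (ih fun i hi => h i (by omega))

theorem exists_mulVec_eq {M : Matrix (Fin b) (Fin b) ℂ} (hM : IsUnit M) (x : Fin b → ℂ) :
    ∃ y, M *ᵥ y = x :=
  ⟨M⁻¹ *ᵥ x, by
    rw [mulVec_mulVec, mul_nonsing_inv _ ((isUnit_iff_isUnit_det _).1 hM), one_mulVec]⟩

/-- Simultaneous induction: modulo the `j`-th Krylov space, `Q_{j+1} B_j ⋯ B_0` equals `H ^ j V`, so
a singular `B_j` would yield a dependence among the Krylov columns. -/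
theorem IsOutput.isUnit_and_mem_krylov (hQ : IsOutput H V k Q A B)
    (hdim : Module.finrank ℂ (krylov H V (k + 1)) = (k + 1) * b) {j : ℕ} (hj : j ≤ k) :
    (∀ i < j, IsUnit (B i)) ∧ (∀ x, Q j *ᵥ x ∈ krylov H V j) ∧
      ∀ y, Q (j + 1) *ᵥ (prodB B (j + 1) *ᵥ y) - (H ^ j * V) *ᵥ y ∈ krylov H V j := by
  induction j with
  | zero =>
    refine ⟨by simp, fun x => by simp [hQ.zero], fun y => ?_⟩
    simp [prodB, mulVec_mulVec, hQ.init.eq_mul]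
  | succ j ih =>
    obtain ⟨hB, hQj, hlead⟩ := ih (by omega)
    have hPj := isUnit_prodB hB
    have hBj : IsUnit (B j) := by
      rw [isUnit_iff_isUnit_det, isUnit_iff_ne_zero]
      intro hdet
      obtain ⟨x, hx0, hx⟩ := exists_mulVec_eq_zero_iff.2 hdet
      -- A kernel vector of `B_j` has the form `B_{j-1} ⋯ B_0 y`. Then `H ^ j V y` lies in the
      -- `j`-th Krylov space, which forces `y = 0`.
      obtain ⟨y, rfl⟩ := exists_mulVec_eq hPj x
      have h1 := hlead y
      rw [prodB, ← mulVec_mulVec (M := B j), hx, mulVec_zero, zero_sub, neg_mem_iff] at h1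
      rw [eq_zero_of_pow_mul_mulVec_mem_krylov hdim (by omega) h1, mulVec_zero] at hx0
      exact hx0 rfl
    have hB' : ∀ i < j + 1, IsUnit (B i) := by
      intro i hi
      rcases Nat.lt_succ_iff_lt_or_eq.1 hi with h | rfl
      · exact hB i h
      · exact hBj
    have hQj' : ∀ x, Q (j + 1) *ᵥ x ∈ krylov H V (j + 1) := by
      intro x
      obtain ⟨y, rfl⟩ := exists_mulVec_eq (isUnit_prodB hB') x
      have := Submodule.add_mem _ (krylov_mono (Nat.le_succ j) (hlead y))
        (pow_mul_mulVec_mem_krylov (H := H) (V := V) (Nat.lt_succ_self j) y)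
      simpa using this
    refine ⟨hB', hQj', fun y => ?_⟩
    have hstep := (hQ.step (j + 1) (by omega) hj).eq_mul
    have heq : Q (j + 1 + 1) *ᵥ (prodB B (j + 1 + 1) *ᵥ y) - (H ^ (j + 1) * V) *ᵥ y =
        H *ᵥ (Q (j + 1) *ᵥ (prodB B (j + 1) *ᵥ y) - (H ^ j * V) *ᵥ y) -
          Q j *ᵥ ((B j)ᴴ *ᵥ (prodB B (j + 1) *ᵥ y)) -
          Q (j + 1) *ᵥ (A (j + 1) *ᵥ (prodB B (j + 1) *ᵥ y)) := by
      rw [prodB, ← mulVec_mulVec (M := B (j + 1)), mulVec_mulVec (M := Q (j + 1 + 1)), ← hstep,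
        mulVec_sub, pow_succ', Matrix.mul_assoc, ← mulVec_mulVec (M := H), sub_mulVec, sub_mulVec]
      simp only [mulVec_mulVec, Nat.add_sub_cancel, Matrix.mul_assoc]
      abel
    rw [heq]
    exact Submodule.sub_mem _ (Submodule.sub_mem _ (mulVec_mem_krylov_succ (hlead y))
      (krylov_mono (Nat.le_succ j) (hQj _))) (hQj' _)

/-- The choice of `A_j` makes `Q_{j+1} B_j` orthogonal to `Q_j`; invertibility of `B_j` passes this
on to `Q_{j+1}`. -/
theorem IsOutput.conjTranspose_mul_succ_eq_zero (hQ : IsOutput H V k Q A B)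
    (hdim : Module.finrank ℂ (krylov H V (k + 1)) = (k + 1) * b) {j : ℕ} (hj : 1 ≤ j)
    (hjk : j < k) : (Q j)ᴴ * Q (j + 1) = 0 := by
  have hB : IsUnit (B j) := (hQ.isUnit_and_mem_krylov hdim le_rfl).1 j hjk
  have hstep := (hQ.step j hj hjk.le).eq_mul
  have horth : (Q j)ᴴ * Q j = 1 := by
    obtain ⟨i, rfl⟩ : ∃ i, j = i + 1 := ⟨j - 1, by omega⟩
    rcases Nat.eq_zero_or_pos i with rfl | hi
    · exact hQ.init.orthonormal
    · exact (hQ.step i hi (by omega)).orthonormal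
  have h0 : (Q j)ᴴ * Q (j + 1) * B j = 0 := by
    rw [Matrix.mul_assoc, ← hstep, Matrix.mul_sub, ← hQ.diag j hj hjk.le, ← Matrix.mul_assoc,
      horth, Matrix.one_mul, sub_self]
  have := congrArg (· * (B j)⁻¹) h0
  simpa [Matrix.mul_assoc, mul_nonsing_inv _ ((isUnit_iff_isUnit_det _).1 hB)] using this

theorem IsOutput.isHermitian_diag (hQ : IsOutput H V k Q A B) (hH : H.IsHermitian)
    (hdim : Module.finrank ℂ (krylov H V (k + 1)) = (k + 1) * b) {j : ℕ} (hj : 1 ≤ j)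
    (hjk : j ≤ k) : (A j).IsHermitian := by
  have h0 : (Q j)ᴴ * Q (j - 1) = 0 := by
    obtain ⟨i, rfl⟩ : ∃ i, j = i + 1 := ⟨j - 1, by omega⟩
    rcases Nat.eq_zero_or_pos i with rfl | hi
    · simp [hQ.zero]
    · have := congrArg conjTranspose (hQ.conjTranspose_mul_succ_eq_zero hdim hi (by omega))
      simpa using this
  have : A j = (Q j)ᴴ * H * Q j := by
    rw [hQ.diag j hj hjk, Matrix.mul_sub, ← Matrix.mul_assoc _ (Q (j - 1)), h0, Matrix.zero_mul,
      sub_zero, Matrix.mul_assoc]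
  rw [this]
  exact isHermitian_conjTranspose_mul_mul _ hH

theorem IsOutput.isHermitian_tridiag (hQ : IsOutput H V k Q A B) (hH : H.IsHermitian)
    (hdim : Module.finrank ℂ (krylov H V (k + 1)) = (k + 1) * b) :
    (tridiag k A B).IsHermitian := by
  refine IsHermitian.ext fun ⟨i, p⟩ ⟨j, q⟩ => ?_
  simp only [tridiag, of_apply]
  rcases eq_or_ne (i : ℕ) j with hij | hij
  · rw [if_pos hij, if_pos hij.symm, ← hij]
    exact (hQ.isHermitian_diag hH hdim (Nat.le_add_left 1 _) (by omega)).apply _ _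
  · rw [if_neg hij, if_neg hij.symm]
    by_cases h1 : (i : ℕ) = j + 1
    · have h2 : ¬ (j : ℕ) = j + 1 + 1 := by omega
      simp [h1, h2, conjTranspose_apply]
    · by_cases h2 : (j : ℕ) = i + 1
      · have h3 : ¬ (i : ℕ) = i + 1 + 1 := by omega
        simp [h2, h3, conjTranspose_apply]
      · simp [h1, h2]

/-! ### The Lanczos relation and the resolvent errors. -/

theorem IsOutput.mul_basis (hQ : IsOutput H V k Q A B) :
    H * basis k Q = basis k Q * tridiag k A B + Q (k + 1) * B k * (blockE k b k)ᴴ := by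
  ext r ⟨j, q⟩
  have hstep := (hQ.step (j + 1) (by omega) (by omega)).eq_mul
  have hHQ : H * Q (j + 1) = Q j * (B j)ᴴ + Q (j + 1) * A (j + 1) + Q (j + 2) * B (j + 1) := by
    rw [← hstep, Nat.add_sub_cancel]; abel
  have hL : (H * basis k Q) r (j, q) = (H * Q (j + 1)) r q := by
    simp [Matrix.mul_apply, basis]
  have hE : (Q (k + 1) * B k * (blockE k b k)ᴴ) r (j, q) =
      if (j : ℕ) + 1 = k then (Q (k + 1) * B k) r q else 0 := by
    rw [Matrix.mul_apply]
    split_ifs with h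
    · simp [blockE, h, apply_ite (starRingEnd ℂ)]
    · simp [blockE, h]
  have hT : (basis k Q * tridiag k A B) r (j, q) = ∑ i : Fin k,
      ((if (i : ℕ) = j then (Q (i + 1) * A (i + 1)) r q else 0) +
        (if (i : ℕ) = j + 1 then (Q (i + 1) * B i) r q else 0) +
        (if (j : ℕ) = i + 1 then (Q (i + 1) * (B j)ᴴ) r q else 0)) := by
    rw [Matrix.mul_apply, Fintype.sum_prod_type]
    refine Finset.sum_congr rfl fun i _ => ?_
    simp only [basis, tridiag, of_apply]
    by_cases h1 : (i : ℕ) = j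
    · simp [h1, Matrix.mul_apply]
    · by_cases h2 : (i : ℕ) = j + 1
      · have h3 : ¬ (j : ℕ) = j + 1 + 1 := by omega
        simp [h2, h3, Matrix.mul_apply]
      · by_cases h3 : (j : ℕ) = i + 1
        · have h4 : ¬ (i : ℕ) = i + 1 + 1 := by omega
          simp [h3, h4, Matrix.mul_apply]
        · simp [h1, h2, h3]
  rw [Matrix.add_apply, hL, hE, hT, hHQ, Matrix.add_apply, Matrix.add_apply,
    Finset.sum_add_distrib, Finset.sum_add_distrib,
    Fin.sum_univ_eq_sum_range (fun i => if i = (j : ℕ) then (Q (i + 1) * A (i + 1)) r q else 0),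
    Fin.sum_univ_eq_sum_range (fun i => if i = (j : ℕ) + 1 then (Q (i + 1) * B i) r q else 0),
    Fin.sum_univ_eq_sum_range (fun i => if (j : ℕ) = i + 1 then (Q (i + 1) * (B j)ᴴ) r q else 0),
    Finset.sum_ite_eq', Finset.sum_ite_eq', if_pos (Finset.mem_range.2 j.2)]
  -- The first block column has no superdiagonal block, in agreement with `Q 0 = 0`.
  have hthird : (∑ i ∈ Finset.range k,
      if (j : ℕ) = i + 1 then (Q (i + 1) * (B j)ᴴ) r q else 0) = (Q j * (B j)ᴴ) r q := by
    rcases Nat.eq_zero_or_pos (j : ℕ) with h0 | hpos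
    · rw [h0, hQ.zero]
      simp
    · rw [Finset.sum_eq_single ((j : ℕ) - 1)]
      · rw [if_pos (by omega), Nat.sub_add_cancel hpos]
      · intro i _ hi
        rw [if_neg (by omega)]
      · intro h
        exact absurd (Finset.mem_range.2 (by omega)) h
  have hlast : ∀ l, l = k → (Q (k + 1) * B k) r q = (Q (l + 1) * B l) r q := by
    rintro l rfl; rfl
  rw [hthird]
  -- In the last block column the subdiagonal block falls outside `T`, and the `E_k` term supplies
  -- it.
  by_cases hjk : (j : ℕ) + 1 = k
  · rw [if_pos hjk, if_neg (by rw [Finset.mem_range]; omega), hlast _ hjk]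
    ring
  · rw [if_neg hjk, if_pos (by rw [Finset.mem_range]; omega)]
    ring

theorem basis_mul_blockE_one (hk : 1 ≤ k) : basis k Q * blockE k b 1 = Q 1 := by
  ext r q
  rw [Matrix.mul_apply, Finset.sum_eq_single ((⟨0, hk⟩ : Fin k), q)]
  · simp [basis, blockE]
  · rintro ⟨i, p⟩ _ hne
    have : ¬ ((i : ℕ) + 1 = 1 ∧ p = q) := by
      rintro ⟨h1, rfl⟩
      exact hne (Prod.ext (Fin.ext (by simpa using h1)) rfl)
    simp [blockE] at this ⊢
    simp +contextual [this]
  · simp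

theorem isUnit_sub_smul_one {ι : Type*} [Fintype ι] [DecidableEq ι] {M : Matrix ι ι ℂ} {z : ℂ}
    (hz : z ∉ spectrum ℂ M) : IsUnit (M - z • (1 : Matrix ι ι ℂ)) := by
  rw [spectrum.notMem_iff, Algebra.algebraMap_eq_smul_one] at hz
  simpa using hz.neg

theorem IsOutput.sub_smul_one_mul_err (hQ : IsOutput H V k Q A B) (hk : 1 ≤ k) {z : ℂ}
    (hzH : z ∉ spectrum ℂ H) (hzT : z ∉ spectrum ℂ (tridiag k A B)) :
    (H - z • 1) * err H V k Q A B z = Q (k + 1) * B k * blockC k A B z := by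
  have hT := (isUnit_iff_isUnit_det _).1 (isUnit_sub_smul_one hzT)
  have hH := (isUnit_iff_isUnit_det _).1 (isUnit_sub_smul_one hzH)
  have hcomm : (H - z • 1) * basis k Q =
      basis k Q * (tridiag k A B - z • 1) + Q (k + 1) * B k * (blockE k b k)ᴴ := by
    rw [Matrix.sub_mul, hQ.mul_basis, Matrix.mul_sub]
    simp only [Matrix.smul_mul, Matrix.one_mul, Matrix.mul_smul, Matrix.mul_one]
    abel
  have hV : V = basis k Q * blockE k b 1 * B 0 := by
    rw [basis_mul_blockE_one hk, ← hQ.init.eq_mul]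
  rw [err, Matrix.mul_sub, mul_nonsing_inv_cancel_left _ _ hH]
  simp only [← Matrix.mul_assoc]
  rw [hcomm, Matrix.add_mul, mul_nonsing_inv_cancel_right _ _ hT, Matrix.add_mul, Matrix.add_mul,
    ← hV, blockC]
  simp only [Matrix.mul_neg, Matrix.mul_assoc]
  abel

/-- The residuals at `z` and `w` share the left factor `Q_{k+1} B_k`, so `C(w)⁻¹ C(z)` on the right
turns one into the other. -/
theorem IsOutput.err_eq (hQ : IsOutput H V k Q A B) (hk : 1 ≤ k) {w z : ℂ}
    (hwH : w ∉ spectrum ℂ H) (hwT : w ∉ spectrum ℂ (tridiag k A B))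
    (hwC : IsUnit (blockC k A B w))
    (hzH : z ∉ spectrum ℂ H) (hzT : z ∉ spectrum ℂ (tridiag k A B)) :
    err H V k Q A B z = (H - z • 1)⁻¹ * (H - w • 1) * err H V k Q A B w *
      ((blockC k A B w)⁻¹ * blockC k A B z) := by
  have hH := (isUnit_iff_isUnit_det _).1 (isUnit_sub_smul_one hzH)
  have hC := (isUnit_iff_isUnit_det _).1 hwC
  have h1 : err H V k Q A B z = (H - z • 1)⁻¹ * (Q (k + 1) * B k * blockC k A B z) := by
    rw [← hQ.sub_smul_one_mul_err hk hzH hzT, nonsing_inv_mul_cancel_left _ _ hH]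
  rw [Matrix.mul_assoc _ (H - w • 1), hQ.sub_smul_one_mul_err hk hwH hwT, h1]
  simp only [Matrix.mul_assoc]
  rw [mul_nonsing_inv_cancel_left _ _ hC]

/-! ### Functional calculus of Hermitian matrices. -/

section FunctionalCalculus

variable {ι : Type*} [Fintype ι] [DecidableEq ι] {M : Matrix ι ι ℂ}

/-- The spectrum is finite, so the continuous functional calculus accepts every function. -/
theorem continuousOn_spectrum (M : Matrix ι ι ℂ) (g : ℂ → ℂ) :
    ContinuousOn g (spectrum ℂ M) :=
  (Matrix.finite_spectrum M).continuousOn g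

/-- The spectral projection of `M` at `a`. -/
noncomputable def spectralProj (M : Matrix ι ι ℂ) (a : ℂ) : Matrix ι ι ℂ :=
  cfc (fun x : ℂ => if x = a then 1 else 0) M

theorem cfc_eq_sum_smul_spectralProj (g : ℂ → ℂ) {Λ : Finset ℂ}
    (hΛ : spectrum ℂ M ⊆ Λ) : cfc g M = ∑ a ∈ Λ, g a • spectralProj M a := by
  have h : Set.EqOn g (fun x => ∑ a ∈ Λ, g a * if x = a then 1 else 0) (spectrum ℂ M) := by
    intro x hx
    simp [Finset.mem_coe.1 (hΛ hx)]
  rw [cfc_congr h]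
  have := cfc_sum (fun a x => g a * if x = a then (1 : ℂ) else 0) M Λ
    (fun i _ => continuousOn_spectrum M _)
  simp only [Finset.sum_fn] at this
  rw [this]
  refine Finset.sum_congr rfl fun a _ => ?_
  exact cfc_const_mul _ _ _ (continuousOn_spectrum M _)

theorem cfc_sub_const (hM : M.IsHermitian) (z : ℂ) : cfc (fun x : ℂ => x - z) M = M - z • 1 := by
  have : IsStarNormal M := hM.isSelfAdjoint.isStarNormal
  rw [cfc_sub (fun x : ℂ => x) (fun _ => z) M (continuousOn_spectrum M _)
    (continuousOn_spectrum M _), cfc_id' ℂ M, cfc_const z M, Algebra.algebraMap_eq_smul_one]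

theorem inv_sub_smul_one_eq_cfc (hM : M.IsHermitian) {z : ℂ} (hz : z ∉ spectrum ℂ M) :
    (M - z • (1 : Matrix ι ι ℂ))⁻¹ = cfc (fun x : ℂ => (x - z)⁻¹) M := by
  have : IsStarNormal M := hM.isSelfAdjoint.isStarNormal
  refine inv_eq_right_inv ?_
  rw [← cfc_sub_const hM, ← cfc_mul _ _ M (continuousOn_spectrum M _)
    (continuousOn_spectrum M _), ← cfc_one ℂ M]
  refine cfc_congr fun x hx => ?_
  have : x - z ≠ 0 := fun h => hz (sub_eq_zero.1 h ▸ hx)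
  simp [this]

theorem inv_sub_smul_one_mul_sub_smul_one (hM : M.IsHermitian) {z : ℂ} (hz : z ∉ spectrum ℂ M)
    (w : ℂ) : (M - z • (1 : Matrix ι ι ℂ))⁻¹ * (M - w • 1) =
      cfc (fun x : ℂ => (x - w) / (x - z)) M := by
  rw [inv_sub_smul_one_eq_cfc hM hz, ← cfc_sub_const hM, ← cfc_mul _ _ M
    (continuousOn_spectrum M _) (continuousOn_spectrum M _)]
  exact cfc_congr fun x _ => (div_eq_inv_mul _ _).symm

theorem enorm_cfc_div_le_ratioSup (hM : M.IsHermitian) {S : Set ℝ} (hS : spectrum ℝ M ⊆ S)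
    {w z : ℂ} (hz : z ∉ spectrum ℂ M) :
    ‖cfc (fun x : ℂ => (x - w) / (x - z)) M‖ₑ ≤ ratioSup S w z := by
  by_cases htop : ratioSup S w z = ⊤
  -- Once the supremum is finite, the estimate reduces to real bounds at the eigenvalues, which are
  -- real and lie in `S`.
  · rw [htop]; exact le_top
  rw [← ENNReal.ofReal_toReal htop, ← ofReal_norm]
  refine ENNReal.ofReal_le_ofReal (norm_cfc_le ENNReal.toReal_nonneg fun x hx => ?_)
  have hre : x = (x.re : ℂ) := hM.isSelfAdjoint.mem_spectrum_eq_re hx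
  have hxS : x.re ∈ S := by
    refine hS ?_
    rw [hre] at hx
    exact spectrum.of_algebraMap_mem (R := ℝ) ℂ hx
  have hne : x - z ≠ 0 := fun h => hz (sub_eq_zero.1 h ▸ hx)
  have hle : ‖((x.re : ℝ) : ℂ) - w‖ₑ / ‖((x.re : ℝ) : ℂ) - z‖ₑ ≤ ratioSup S w z :=
    le_iSup₂ (f := fun (y : ℝ) (_ : y ∈ S) => ‖(y : ℂ) - w‖ₑ / ‖(y : ℂ) - z‖ₑ) x.re hxS
  rw [← hre, ← ofReal_norm, ← ofReal_norm, ← ENNReal.ofReal_div_of_pos (norm_pos_iff.2 hne),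
    ← norm_div] at hle
  exact (ENNReal.ofReal_le_iff_le_toReal htop).1 hle

end FunctionalCalculus

/-! ### Compatibility of the norms with multiplication. -/

theorem frobeniusNorm_conjTranspose (X : Matrix (Fin n) (Fin b) ℂ) :
    frobeniusNorm Xᴴ = frobeniusNorm X := by
  rw [frobeniusNorm, frobeniusNorm, Finset.sum_comm]
  simp [conjTranspose_apply]

theorem frobeniusNorm_mul_le (G : Matrix (Fin n) (Fin n) ℂ) (X : Matrix (Fin n) (Fin b) ℂ) :
    frobeniusNorm (G * X) ≤ ‖G‖ * frobeniusNorm X := by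
  rw [frobeniusNorm, frobeniusNorm]
  refine Real.sqrt_le_iff.2 ⟨by positivity, ?_⟩
  rw [mul_pow, Real.sq_sqrt (by positivity), Finset.sum_comm, Finset.sum_comm (s := Finset.univ)
    (t := Finset.univ) (f := fun i j => ‖X i j‖ ^ 2), Finset.mul_sum]
  refine Finset.sum_le_sum fun j _ => ?_
  have h := l2_opNorm_mulVec G (WithLp.toLp 2 fun i => X i j)
  have h2 := pow_le_pow_left₀ (norm_nonneg _) h 2
  rw [mul_pow, EuclideanSpace.norm_sq_eq, EuclideanSpace.norm_sq_eq] at h2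
  exact h2

theorem frobeniusNorm_mul_right_le (X : Matrix (Fin n) (Fin b) ℂ)
    (N : Matrix (Fin b) (Fin b) ℂ) : frobeniusNorm (X * N) ≤ frobeniusNorm X * ‖N‖ := by
  rw [← frobeniusNorm_conjTranspose, conjTranspose_mul, mul_comm (frobeniusNorm X),
    ← frobeniusNorm_conjTranspose X, ← l2_opNorm_conjTranspose N]
  exact frobeniusNorm_mul_le _ _

/-- The map `X ↦ R X`, with the Frobenius norm on its target. -/
noncomputable def mulLeftEuclidean (R : Matrix (Fin n) (Fin n) ℂ) :
    Matrix (Fin n) (Fin b) ℂ →ₗ[ℂ] EuclideanSpace ℂ (Fin n × Fin b) where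
  toFun X := WithLp.toLp 2 fun p => (R * X) p.1 p.2
  map_add' X Y := by ext p; simp [Matrix.mul_add]
  map_smul' a X := by ext p; simp

theorem norm_mulLeftEuclidean (R : Matrix (Fin n) (Fin n) ℂ) (X : Matrix (Fin n) (Fin b) ℂ) :
    ‖mulLeftEuclidean R X‖ = frobeniusNorm (R * X) := by
  rw [EuclideanSpace.norm_eq, frobeniusNorm, Fintype.sum_prod_type]
  rfl

/-- Commutation brings `G` to the left of `R`, where its operator norm can be split off. -/
theorem norm_mulLeftEuclidean_mul_le {R G : Matrix (Fin n) (Fin n) ℂ} (hRG : Commute R G)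
    (X : Matrix (Fin n) (Fin b) ℂ) (N : Matrix (Fin b) (Fin b) ℂ) :
    ‖mulLeftEuclidean R (G * X * N)‖ ≤ ‖G‖ * ‖mulLeftEuclidean R X‖ * ‖N‖ := by
  rw [norm_mulLeftEuclidean, norm_mulLeftEuclidean,
    show R * (G * X * N) = G * (R * X) * N by
      rw [← Matrix.mul_assoc, ← Matrix.mul_assoc, hRG.eq, Matrix.mul_assoc G]]
  exact (frobeniusNorm_mul_right_le _ _).trans
    (mul_le_mul_of_nonneg_right (frobeniusNorm_mul_le _ _) (norm_nonneg _))

theorem commute_cfc_sqrt (hH : H.IsHermitian) (h : ℝ → ℝ)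
    (g : ℂ → ℂ) : Commute (cfc Real.sqrt (cfc h H)) (cfc g H) := by
  have h1 : Commute H (cfc g H) := by
    have : IsStarNormal H := hH.isSelfAdjoint.isStarNormal
    simpa only [cfc_id' ℂ H] using cfc_commute_cfc (fun x : ℂ => x) g H
  have h2 : Commute (cfc h H) (cfc g H) := hH.isSelfAdjoint.commute_cfc h1 h
  have h3 : IsSelfAdjoint (cfc h H) := cfc_predicate h H
  exact h3.commute_cfc h2 Real.sqrt

/-! ### Contour representation of the error and the bound. -/

/-- The coefficient of the pole `a` in the partial fraction expansion of the error of the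
block-Lanczos approximation to the resolvent. -/
noncomputable def errCoeff (H : Matrix (Fin n) (Fin n) ℂ) (V : Matrix (Fin n) (Fin b) ℂ) (k : ℕ)
    (Q : ℕ → Matrix (Fin n) (Fin b) ℂ) (A B : ℕ → Matrix (Fin b) (Fin b) ℂ) (a : ℂ) :
    Matrix (Fin n) (Fin b) ℂ :=
  spectralProj H a * V - basis k Q * spectralProj (tridiag k A B) a * blockE k b 1 * B 0

/-- The coefficients do not depend on `g`. Taking `g` to be `f` or `x ↦ (x - z)⁻¹` reduces the
contour representation to the scalar Cauchy formula. -/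
theorem cfc_mul_sub_eq_sum_errCoeff (g : ℂ → ℂ) {Λ : Finset ℂ} (hΛH : spectrum ℂ H ⊆ Λ)
    (hΛT : spectrum ℂ (tridiag k A B) ⊆ Λ) :
    cfc g H * V - basis k Q * cfc g (tridiag k A B) * blockE k b 1 * B 0 =
      ∑ a ∈ Λ, g a • errCoeff H V k Q A B a := by
  rw [cfc_eq_sum_smul_spectralProj g hΛH, cfc_eq_sum_smul_spectralProj g hΛT]
  simp only [errCoeff, smul_sub, Finset.sum_sub_distrib, Matrix.sum_mul, Matrix.mul_sum,
    Matrix.smul_mul, Matrix.mul_smul]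

open MeasureTheory Complex in
/-- The error of the block-Lanczos approximation to `f(H) V` is a contour integral of the errors
for the resolvents. -/
theorem two_pi_I_smul_apply_error {E : Type*} [NormedAddCommGroup E] [NormedSpace ℂ E]
    [CompleteSpace E] (L : Matrix (Fin n) (Fin b) ℂ →ₗ[ℂ] E)
    (hH : H.IsHermitian) (hT : (tridiag k A B).IsHermitian) {m : ℕ} {Γ : Fin m → Curve}
    (hΓH : ∀ z ∈ spectrum ℂ H, Encloses Γ z)
    (hΓT : ∀ z ∈ spectrum ℂ (tridiag k A B), Encloses Γ z) {f : ℂ → ℂ}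
    (hfc : ∀ i, ContinuousOn f ((Γ i).inside ∪ (Γ i).trace))
    (hfd : ∀ i, DifferentiableOn ℂ f (Γ i).inside) :
    (2 * Real.pi * I : ℂ) • L (cfc f H * V - lan k Q A B f) =
      -∑ i, ∫ t in (0 : ℝ)..1, (f ((Γ i).toFun t) * deriv (Γ i).toFun t) •
        L (err H V k Q A B ((Γ i).toFun t)) := by
  set Λ : Finset ℂ := (Matrix.finite_spectrum H).toFinset ∪
    (Matrix.finite_spectrum (tridiag k A B)).toFinset with hΛ
  have hΛH : spectrum ℂ H ⊆ Λ := by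
    rw [hΛ, Finset.coe_union, Set.Finite.coe_toFinset]; exact Set.subset_union_left
  have hΛT : spectrum ℂ (tridiag k A B) ⊆ Λ := by
    rw [hΛ, Finset.coe_union, Set.Finite.coe_toFinset, Set.Finite.coe_toFinset]
    exact Set.subset_union_right
  have henc : ∀ a ∈ Λ, Encloses Γ a := by
    intro a ha
    rw [hΛ, Finset.mem_union, Set.Finite.mem_toFinset, Set.Finite.mem_toFinset] at ha
    exact ha.elim (hΓH a) (hΓT a)
  have herr : ∀ i, ∀ z ∈ (Γ i).trace, err H V k Q A B z =
      ∑ a ∈ Λ, (a - z)⁻¹ • errCoeff H V k Q A B a := by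
    intro i z hz
    rw [err, inv_sub_smul_one_eq_cfc hH fun h => (hΓH z h).1 i hz,
      inv_sub_smul_one_eq_cfc hT fun h => (hΓT z h).1 i hz,
      cfc_mul_sub_eq_sum_errCoeff _ hΛH hΛT]
  have hint : ∀ i, ∀ a ∈ Λ, IntervalIntegrable
      (fun t => f ((Γ i).path t) * ((Γ i).path t - a)⁻¹ * deriv (Γ i).path t) volume 0 1 := by
    intro i a ha
    obtain ⟨K, hK⟩ := (Γ i).exists_lipschitzWith_path
    refine intervalIntegrable_pathIntegral hK (g := fun ζ => f ζ * (ζ - a)⁻¹) ?_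
    rw [Curve.image_path]
    refine ((hfc i).mono Set.subset_union_right).mul (ContinuousOn.inv₀ (by fun_prop) ?_)
    intro z hz h
    rw [sub_eq_zero] at h
    exact (henc a ha).1 i (h ▸ hz)
  have hpiece : ∀ i, ∫ t in (0 : ℝ)..1, (f ((Γ i).toFun t) * deriv (Γ i).toFun t) •
        L (err H V k Q A B ((Γ i).toFun t)) =
      -∑ a ∈ Λ, pathIntegral (Γ i).path (fun ζ => f ζ * (ζ - a)⁻¹) •
        L (errCoeff H V k Q A B a) := by
    intro i
    simp_rw [pathIntegral, ← intervalIntegral.integral_smul_const]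
    rw [← intervalIntegral.integral_finsetSum fun a ha =>
        ⟨(hint i a ha).1.smul_const _, (hint i a ha).2.smul_const _⟩,
      ← intervalIntegral.integral_neg, intervalIntegral.integral_of_le zero_le_one,
      intervalIntegral.integral_of_le zero_le_one, integral_Ioc_eq_integral_Ioo,
      integral_Ioc_eq_integral_Ioo]
    refine setIntegral_congr_fun measurableSet_Ioo fun t ht => ?_
    have ht' := Set.Ioo_subset_Icc_self ht
    simp only [(Γ i).deriv_path ht, (Γ i).path_of_mem ht', herr i _ ⟨t, ht', rfl⟩, map_sum,
      map_smul, Finset.smul_sum, ← Finset.sum_neg_distrib, smul_smul, ← neg_smul]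
    refine Finset.sum_congr rfl fun a _ => ?_
    rw [← neg_sub ((Γ i).toFun t) a, inv_neg]
    congr 1
    ring
  rw [Finset.sum_congr rfl fun i _ => hpiece i, Finset.sum_neg_distrib, neg_neg, lan,
    cfc_mul_sub_eq_sum_errCoeff f hΛH hΛT, map_sum, Finset.smul_sum, Finset.sum_comm]
  refine Finset.sum_congr rfl fun a ha => ?_
  rw [← Finset.sum_smul, sum_pathIntegral_mul_inv_sub hfc hfd (henc a ha), map_smul, smul_smul]

open MeasureTheory Complex in
/-- The error bound, for any norm pulled back along a linear map that is compatible with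
multiplication by functions of `H` on the left and by arbitrary matrices on the right. -/
theorem ofReal_norm_apply_error_le {E : Type*} [NormedAddCommGroup E] [NormedSpace ℂ E]
    [CompleteSpace E] (L : Matrix (Fin n) (Fin b) ℂ →ₗ[ℂ] E)
    (hL : ∀ (g : ℂ → ℂ) (X : Matrix (Fin n) (Fin b) ℂ) (N : Matrix (Fin b) (Fin b) ℂ),
      ‖L (cfc g H * X * N)‖ ≤ ‖cfc g H‖ * ‖L X‖ * ‖N‖)
    (hk : 1 ≤ k) (hH : H.IsHermitian)
    (hdim : Module.finrank ℂ (krylov H V (k + 1)) = (k + 1) * b) (hQ : IsOutput H V k Q A B)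
    {S : Set ℝ} (hS : spectrum ℝ H ⊆ S) {w : ℂ} (hwH : w ∉ spectrum ℂ H)
    (hwT : w ∉ spectrum ℂ (tridiag k A B)) (hwC : IsUnit (blockC k A B w))
    {m : ℕ} {Γ : Fin m → Curve} (hΓH : ∀ z ∈ spectrum ℂ H, Encloses Γ z)
    (hΓT : ∀ z ∈ spectrum ℂ (tridiag k A B), Encloses Γ z) {f : ℂ → ℂ}
    (hfc : ∀ i, ContinuousOn f ((Γ i).inside ∪ (Γ i).trace))
    (hfd : ∀ i, DifferentiableOn ℂ f (Γ i).inside) :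
    ENNReal.ofReal ‖L (cfc f H * V - lan k Q A B f)‖ ≤
      integralTerm Γ f S k A B w * ENNReal.ofReal ‖L (err H V k Q A B w)‖ := by
  have hT := hQ.isHermitian_tridiag hH hdim
  have hid := two_pi_I_smul_apply_error (V := V) (Q := Q) L hH hT hΓH hΓT hfc hfd
  have hpt : ∀ i, ∀ z ∈ (Γ i).trace, ‖L (err H V k Q A B z)‖ₑ ≤ ratioSup S w z *
      ENNReal.ofReal ‖(blockC k A B w)⁻¹ * blockC k A B z‖ *
        ENNReal.ofReal ‖L (err H V k Q A B w)‖ := by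
    intro i z hz
    have hzH : z ∉ spectrum ℂ H := fun h => (hΓH z h).1 i hz
    have hzT : z ∉ spectrum ℂ (tridiag k A B) := fun h => (hΓT z h).1 i hz
    rw [hQ.err_eq hk hwH hwT hwC hzH hzT, inv_sub_smul_one_mul_sub_smul_one hH hzH, ← ofReal_norm]
    refine (ENNReal.ofReal_le_ofReal (hL _ _ _)).trans ?_
    rw [ENNReal.ofReal_mul (by positivity), ENNReal.ofReal_mul (norm_nonneg _), mul_right_comm,
      ofReal_norm (cfc _ H)]
    gcongr
    exact enorm_cfc_div_le_ratioSup hH hS hzH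
  have hint : ∀ i, ‖∫ t in (0 : ℝ)..1, (f ((Γ i).toFun t) * deriv (Γ i).toFun t) •
        L (err H V k Q A B ((Γ i).toFun t))‖ₑ ≤
      ((Γ i).arcIntegral fun z => ‖f z‖ₑ * ratioSup S w z *
        ENNReal.ofReal ‖(blockC k A B w)⁻¹ * blockC k A B z‖) *
          ENNReal.ofReal ‖L (err H V k Q A B w)‖ := by
    intro i
    rw [intervalIntegral.integral_of_le zero_le_one, Curve.arcIntegral,
      ← lintegral_mul_const' _ _ ENNReal.ofReal_ne_top]
    refine (enorm_integral_le_lintegral_enorm _).trans ?_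
    refine (lintegral_mono_set Set.Ioc_subset_Icc_self).trans ?_
    refine setLIntegral_mono' measurableSet_Icc fun t ht => ?_
    rw [enorm_smul, enorm_mul]
    refine (mul_le_mul_right (hpt i _ ⟨t, ht, rfl⟩) _).trans (le_of_eq ?_)
    ring
  have h2pi : ‖(2 * Real.pi * I : ℂ)‖ₑ = ENNReal.ofReal (2 * Real.pi) := by
    rw [← ofReal_norm]
    simp [abs_of_pos Real.pi_pos]
  have hmain : ENNReal.ofReal (2 * Real.pi) * ENNReal.ofReal ‖L (cfc f H * V - lan k Q A B f)‖ ≤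
      (∑ i, (Γ i).arcIntegral fun z => ‖f z‖ₑ * ratioSup S w z *
        ENNReal.ofReal ‖(blockC k A B w)⁻¹ * blockC k A B z‖) *
          ENNReal.ofReal ‖L (err H V k Q A B w)‖ := by
    rw [ofReal_norm (L (cfc f H * V - lan k Q A B f)), ← h2pi, ← enorm_smul, hid, enorm_neg,
      Finset.sum_mul]
    exact (enorm_sum_le _ _).trans (Finset.sum_le_sum fun i _ => hint i)
  have h0 : ENNReal.ofReal (2 * Real.pi) ≠ 0 := by simp [Real.pi_pos]
  rw [integralTerm, mul_assoc, ← ENNReal.inv_mul_cancel_left h0 ENNReal.ofReal_ne_top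
    (b := ENNReal.ofReal ‖L (cfc f H * V - lan k Q A B f)‖)]
  gcongr

end BlockLanczos

theorem theorem2p1 {n b k : ℕ} (hk : 1 ≤ k)
    (H : Matrix (Fin n) (Fin n) ℂ) (hH : H.IsHermitian) (V : Matrix (Fin n) (Fin b) ℂ)
    (hdim : Module.finrank ℂ (BlockLanczos.krylov H V (k + 1)) = (k + 1) * b)
    (Q : ℕ → Matrix (Fin n) (Fin b) ℂ) (A B : ℕ → Matrix (Fin b) (Fin b) ℂ)
    (hQ : BlockLanczos.IsOutput H V k Q A B)
    (S : Set ℝ) (hS : spectrum ℝ H ⊆ S)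
    (w : ℂ) (hwH : w ∉ spectrum ℂ H) (hwT : w ∉ spectrum ℂ (BlockLanczos.tridiag k A B))
    (hwC : IsUnit (BlockLanczos.blockC k A B w))
    {m : ℕ} (Γ : Fin m → BlockLanczos.Curve)
    (hΓH : ∀ z ∈ spectrum ℂ H, BlockLanczos.Encloses Γ z)
    (hΓT : ∀ z ∈ spectrum ℂ (BlockLanczos.tridiag k A B), BlockLanczos.Encloses Γ z)
    (f : ℂ → ℂ)
    (hfc : ∀ i, ContinuousOn f ((Γ i).inside ∪ (Γ i).trace))
    (hfa : ∀ i, AnalyticOnNhd ℂ f (Γ i).inside) :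
    (∀ h : ℝ → ℝ, (cfc h H).PosDef →
      ENNReal.ofReal (BlockLanczos.inducedNorm (cfc h H)
          (cfc f H * V - BlockLanczos.lan k Q A B f)) ≤
        BlockLanczos.integralTerm Γ f S k A B w *
          ENNReal.ofReal (BlockLanczos.inducedNorm (cfc h H)
            (BlockLanczos.err H V k Q A B w))) ∧
    ENNReal.ofReal ‖cfc f H * V - BlockLanczos.lan k Q A B f‖ ≤
      BlockLanczos.integralTerm Γ f S k A B w *
        ENNReal.ofReal ‖BlockLanczos.err H V k Q A B w‖ := by
  have hfd : ∀ i, DifferentiableOn ℂ f (Γ i).inside := fun i => (hfa i).differentiableOn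
  refine ⟨fun h _ => ?_, ?_⟩
  -- Here `L` is left multiplication by `h(H)^{1/2}`, which commutes with every function of `H`.
  · have := BlockLanczos.ofReal_norm_apply_error_le
      (BlockLanczos.mulLeftEuclidean (b := b) (cfc Real.sqrt (cfc h H)))
      (fun g X N => BlockLanczos.norm_mulLeftEuclidean_mul_le
        (BlockLanczos.commute_cfc_sqrt hH h g) X N)
      hk hH hdim hQ hS hwH hwT hwC hΓH hΓT hfc hfd
    simpa only [BlockLanczos.norm_mulLeftEuclidean, BlockLanczos.inducedNorm] using this
  · have : CompleteSpace (Matrix (Fin n) (Fin b) ℂ) := FiniteDimensional.complete ℂ _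
    refine BlockLanczos.ofReal_norm_apply_error_le LinearMap.id (fun g X N => ?_)
      hk hH hdim hQ hS hwH hwT hwC hΓH hΓT hfc hfd
    exact (l2_opNorm_mul _ _).trans
      (mul_le_mul_of_nonneg_right (l2_opNorm_mul _ _) (norm_nonneg _))
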